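/- Let $a\in\mathbb{Q}$. A pair $(x_0,x_1)\in\mathbb{Q}\times\mathbb{Q}$ of initial conditions generates a sequence of period $9$ of the Lyness recurrence $$x_{n+2}=\frac{a+x_{n+1}}{x_n},\qquad n\ge 0,$$ if the infinite sequence $(x_n)_{n\ge0}$ is well defined (i.e. $x_n\neq 0$ for all $n\ge 0$) and $9$ is its prime period, i.e. the least integer $d\ge1$ such that $x_{n+d}=x_n$ for all $n\ge0$. (i) For $a\in\{6,8\}$ there are no initial conditions $(x_0,x_1)\in\mathbb{Q}\times\mathbb{Q}$ that generate a sequence of period $9$. (ii) For $a=9$ there are no initial conditions $(x_0,x_1)\in\mathbb{Q}^+\times\mathbb{Q}^+$ that generate a sequence of period $9$, but there are infinitely many such initial conditions in $\mathbb{Q}\times\mathbb{Q}$. Here $\mathbb{Q}^+$ is the set of positive rational numbers. -/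

import Mathlib

/-- `x` is a sequence of rational numbers generated by the Lyness recurrence
`x_{n+2} = (a + x_{n+1}) / x_n`. The recurrence divides by every term of the sequence, so the
infinite sequence exists only if no term vanishes. -/
def IsLynessSequence (a : ℚ) (x : ℕ → ℚ) : Prop :=
  ∀ n : ℕ, x n ≠ 0 ∧ x (n + 2) = (a + x (n + 1)) / x n

/-- `p` is the period (that is, the prime or least positive period) of the sequence `x`. -/
def HasPeriod (x : ℕ → ℚ) (p : ℕ) : Prop :=
  IsLeast {d : ℕ | 0 < d ∧ Function.Periodic x d} p

/-- The initial conditions `x₀ = c.1`, `x₁ = c.2` such that the Lyness recurrence with parameter `a`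
generates a well-defined sequence of period `p`. -/
def lynessPeriodic (a : ℚ) (p : ℕ) : Set (ℚ × ℚ) :=
  {c | ∃ x : ℕ → ℚ, IsLynessSequence a x ∧ x 0 = c.1 ∧ x 1 = c.2 ∧ HasPeriod x p}

/-!
Multiplying the recurrence out, a sequence of period nine lies on a cubic curve; for `a = 9` this
curve contains no point with positive coordinates, but it has a rational point of infinite order,
whose multiples give infinitely many sequences.

For `a = 6` and `a = 8` the curve maps to a Hesse cubic `s (p³ + q³ + r³) = n p q r`, on which we
descend with respect to the exponent of `3` in a coordinate. Over the Eisenstein integers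
`n³ - 27 s³` times a cube splits into linear forms, and congruences modulo `18` force these to be
cubes up to a rational integer. The linear form of the cube root and its conjugates then give
three integers with sum `n g` and product `(s g)³`, and cubic residue characters show that these are
cubes. Their cube roots are another point of the same Hesse cubic, with fewer factors `3`.
-/

/-- The cubic curve of pairs `(x, y)` of consecutive terms of Lyness sequences of period nine. -/
def OnNineCycleCurve (a x y : ℚ) : Prop :=
  a * (x + 1) * (y + 1) * (x + y + a) = (a - 1) * (a ^ 2 - a + 1) * (x * y)

namespace IsLynessSequence

variable {a : ℚ} {x : ℕ → ℚ}

theorem mul_eq (h : IsLynessSequence a x) (n : ℕ) : x (n + 2) * x n = a + x (n + 1) := by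
  rw [(h n).2, div_mul_cancel₀ _ (h n).1]

theorem add_ne_zero (h : IsLynessSequence a x) (n : ℕ) : a + x (n + 1) ≠ 0 := by
  rw [← h.mul_eq]
  exact mul_ne_zero (h _).1 (h _).1

theorem shift (h : IsLynessSequence a x) (k : ℕ) : IsLynessSequence a fun n => x (n + k) := by
  intro n
  convert h (n + k) using 3 <;> ring_nf

theorem reverse (h : IsLynessSequence a x) (hx : Function.Periodic x 9) :
    IsLynessSequence a fun n => x (8 * n + 1) := by
  intro n
  refine ⟨(h _).1, ?_⟩
  have h17 : x (8 * (n + 2) + 1) = x (8 * n + 8) := hx (8 * n + 8)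
  have h10 : x (8 * n + 8 + 2) = x (8 * n + 1) := hx (8 * n + 1)
  have hmul := h.mul_eq (8 * n + 8)
  rw [h10] at hmul
  change x (8 * (n + 2) + 1) = _ / x (8 * n + 1)
  rw [h17, eq_div_iff (h _).1, mul_comm]
  exact hmul

theorem apply_three (h : IsLynessSequence a x) :
    x 3 = (a * x 0 + a + x 1) / (x 0 * x 1) := by
  have h0 := (h 0).1
  have h1 := (h 1).1
  rw [(h 1).2, (h 0).2]
  field_simp
  ring

theorem apply_four (h : IsLynessSequence a x) :
    x 4 = (a * x 0 * x 1 + a * x 0 + a + x 1) / (x 1 * (a + x 1)) := by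
  have h0 := (h 0).1
  have h1 := (h 1).1
  have h2 := h.add_ne_zero 0
  rw [(h 2).2, h.apply_three, (h 0).2]
  field_simp
  ring

theorem apply_six (h : IsLynessSequence a x) (hx : Function.Periodic x 9) :
    x 6 = (a * x 0 * x 1 + a * x 1 + a + x 0) / (x 0 * (a + x 0)) := by
  have hrev := (h.reverse hx).apply_four
  rwa [hx 24, hx 15, hx 6, hx 0, mul_right_comm a] at hrev

theorem add_apply_zero_ne_zero (h : IsLynessSequence a x) (hx : Function.Periodic x 9) :
    a + x 0 ≠ 0 :=
  hx 0 ▸ h.add_ne_zero 8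

theorem apply_three_eq_or_onNineCycleCurve (h : IsLynessSequence a x)
    (hx : Function.Periodic x 9) : x 3 = x 0 ∨ OnNineCycleCurve a (x 0) (x 1) := by
  have h0 := (h 0).1
  have h1 := (h 1).1
  have ha0 := h.add_apply_zero_ne_zero hx
  have ha1 := h.add_ne_zero 0
  have hclose : x 4 * x 6 * x 3 = a * x 3 + a + x 4 := by
    linear_combination x 3 * h.mul_eq 4 + h.mul_eq 3
  rw [h.apply_four, h.apply_six hx, h.apply_three] at hclose
  field_simp at hclose
  have hfactor : (a * x 0 + a + x 1 - x 0 ^ 2 * x 1) *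
      (a * (x 0 + 1) * (x 1 + 1) * (x 0 + x 1 + a) -
        (a - 1) * (a ^ 2 - a + 1) * (x 0 * x 1)) = 0 := by
    linear_combination hclose
  rcases mul_eq_zero.1 hfactor with h3 | hC
  · left
    rw [h.apply_three, div_eq_iff (mul_ne_zero h0 h1)]
    linear_combination h3
  · exact .inr (sub_eq_zero.1 hC)

theorem onNineCycleCurve_of_succ (h : IsLynessSequence a x) {n : ℕ}
    (hC : OnNineCycleCurve a (x (n + 1)) (x (n + 2))) : OnNineCycleCurve a (x n) (x (n + 1)) := by
  have hx := h.mul_eq n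
  unfold OnNineCycleCurve at hC ⊢
  refine mul_right_cancel₀ (h (n + 2)).1 ?_
  linear_combination
    x n * hC - (a * (x (n + 1) + 1)) * (x (n + 2) - x n) * hx

theorem onNineCycleCurve (h : IsLynessSequence a x) (hp : HasPeriod x 9) :
    OnNineCycleCurve a (x 0) (x 1) := by
  by_contra hC
  have hn (n : ℕ) : ¬ OnNineCycleCurve a (x n) (x (n + 1)) := by
    induction n with
    | zero => exact hC
    | succ n ih => exact fun hC' => ih (h.onNineCycleCurve_of_succ hC')
  have hper : Function.Periodic x 3 := fun n => by
    have := ((h.shift n).apply_three_eq_or_onNineCycleCurve (hp.1.2.add_const n)).resolve_right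
      (by simpa only [zero_add, add_comm 1 n] using hn n)
    simpa only [zero_add, add_comm n] using this
  exact absurd (hp.2 ⟨by norm_num, hper⟩) (by norm_num)

end IsLynessSequence

/-- The Lyness cycle of length nine through a point `(x, y)` of `OnNineCycleCurve a`, with the six
further terms in a form symmetric under the reversal `(x, y) ↦ (y, x)`. -/
def nineCycle (a x y : ℚ) : ZMod 9 → ℚ :=
  ![x, y, (a + y) / x, (a * x + a + y) / (x * y),
    (a * x * y + a * x + a + y) / (y * (a + y)), a * (a - 1) * x * y / ((a + x) * (a + y)),
    (a * x * y + a * y + a + x) / (x * (a + x)), (a * y + a + x) / (x * y), (a + x) / y]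

section nineCycle

variable {a x y : ℚ}

theorem OnNineCycleCurve.symm (hC : OnNineCycleCurve a x y) : OnNineCycleCurve a y x := by
  unfold OnNineCycleCurve at hC ⊢
  linear_combination hC

theorem OnNineCycleCurve.mul_numerators_eq (hC : OnNineCycleCurve a x y) :
    (a * x + a + y) * (a * x * y + a * y + a + x) = a * (a - 1) * y * x * (a + x) := by
  unfold OnNineCycleCurve at hC
  linear_combination hC

theorem nineCycle_ne_zero (hC : OnNineCycleCurve a x y) (ha : a ≠ 0) (ha1 : a ≠ 1) (hx : x ≠ 0)
    (hy : y ≠ 0) (hax : a + x ≠ 0) (hay : a + y ≠ 0) (i : ZMod 9) : nineCycle a x y i ≠ 0 := by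
  have hxy := mul_ne_zero (mul_ne_zero (mul_ne_zero ha (sub_ne_zero.2 ha1)) hx) hy
  have hyx := mul_ne_zero (mul_ne_zero (mul_ne_zero ha (sub_ne_zero.2 ha1)) hy) hx
  obtain ⟨h3, h6⟩ := mul_ne_zero_iff.1 (hC.mul_numerators_eq ▸ mul_ne_zero hyx hax)
  obtain ⟨h7, h4⟩ := mul_ne_zero_iff.1 (hC.symm.mul_numerators_eq ▸ mul_ne_zero hxy hay)
  rw [mul_right_comm] at h4
  fin_cases i
  exacts [hx, hy, div_ne_zero hay hx, div_ne_zero h3 (by positivity),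
    div_ne_zero h4 (by positivity), div_ne_zero hxy (by positivity),
    div_ne_zero h6 (by positivity), div_ne_zero h7 (by positivity), div_ne_zero hax hy]

theorem nineCycle_mul (hC : OnNineCycleCurve a x y) (hx : x ≠ 0) (hy : y ≠ 0) (hax : a + x ≠ 0)
    (hay : a + y ≠ 0) (i : ZMod 9) :
    nineCycle a x y (i + 2) * nineCycle a x y i = a + nineCycle a x y (i + 1) := by
  unfold OnNineCycleCurve at hC
  fin_cases i
  · change (a + y) / x * x = a + y
    field_simp
  · change (a * x + a + y) / (x * y) * y = a + (a + y) / x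
    field_simp
    ring
  · change (a * x * y + a * x + a + y) / (y * (a + y)) * ((a + y) / x) =
      a + (a * x + a + y) / (x * y)
    field_simp
    ring
  · change a * (a - 1) * x * y / ((a + x) * (a + y)) * ((a * x + a + y) / (x * y)) =
      a + (a * x * y + a * x + a + y) / (y * (a + y))
    field_simp
    linear_combination -hC
  · change (a * x * y + a * y + a + x) / (x * (a + x)) *
      ((a * x * y + a * x + a + y) / (y * (a + y))) =
      a + a * (a - 1) * x * y / ((a + x) * (a + y))
    field_simp
    linear_combination hC
  · change (a * y + a + x) / (x * y) * (a * (a - 1) * x * y / ((a + x) * (a + y))) =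
      a + (a * x * y + a * y + a + x) / (x * (a + x))
    field_simp
    linear_combination -hC
  · change (a + x) / y * ((a * x * y + a * y + a + x) / (x * (a + x))) =
      a + (a * y + a + x) / (x * y)
    field_simp
    ring
  · change x * ((a * y + a + x) / (x * y)) = a + (a + x) / y
    field_simp
    ring
  · change y * ((a + x) / y) = a + x
    field_simp

theorem nineCycle_zero_mul_three_mul_six (hC : OnNineCycleCurve a x y) (hx : x ≠ 0) (hy : y ≠ 0)
    (hax : a + x ≠ 0) :
    nineCycle a x y 0 * nineCycle a x y 3 * nineCycle a x y 6 = a * (a - 1) := by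
  change x * ((a * x + a + y) / (x * y)) * ((a * x * y + a * y + a + x) / (x * (a + x))) = _
  field_simp
  linear_combination hC.mul_numerators_eq

theorem hasPeriod_nine_of_ne {w : ZMod 9 → ℚ} (hw : ¬ (w 3 = w 0 ∧ w 6 = w 0)) :
    HasPeriod (fun n => w n) 9 := by
  refine ⟨⟨by norm_num, fun n => ?_⟩, fun d ⟨hd, hper⟩ => ?_⟩
  · exact congrArg w (by push_cast; exact add_eq_left.2 (by decide))
  · by_contra! hd9
    have hperiod : Function.Periodic w d := fun i => by
      simpa using hper i.val
    have hgen : ∀ d : Fin 9, d ≠ 0 → ∃ k : Fin 9, (k.val : ZMod 9) * d.val = 3 := by decide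
    obtain ⟨k, hk⟩ := hgen ⟨d, hd9⟩ (by simpa [Fin.ext_iff] using hd.ne')
    have h3 : Function.Periodic w 3 := hk ▸ hperiod.nat_mul k
    exact hw ⟨by simpa using h3 0, (h3 3).trans (by simpa using h3 0)⟩

/-- Period three is excluded because `x₀ x₃ x₆ = a (a - 1)` would then be a cube. -/
theorem mem_lynessPeriodic_nine (hC : OnNineCycleCurve a x y) (ha : ∀ c : ℚ, c ^ 3 ≠ a * (a - 1))
    (hx : x ≠ 0) (hy : y ≠ 0) (hax : a + x ≠ 0) (hay : a + y ≠ 0) :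
    (x, y) ∈ lynessPeriodic a 9 := by
  have ha0 : a ≠ 0 := by
    rintro rfl
    exact ha 0 (by norm_num)
  have ha1 : a ≠ 1 := by
    rintro rfl
    exact ha 0 (by norm_num)
  have hne := nineCycle_ne_zero hC ha0 ha1 hx hy hax hay
  refine ⟨fun n => nineCycle a x y n, fun n => ⟨hne _, ?_⟩, rfl, rfl, hasPeriod_nine_of_ne ?_⟩
  · rw [eq_div_iff (hne _)]
    push_cast
    exact nineCycle_mul hC hx hy hax hay n
  · rintro ⟨h3, h6⟩
    have hprod := nineCycle_zero_mul_three_mul_six hC hx hy hax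
    rw [h3, h6] at hprod
    exact ha (nineCycle a x y 0) (by rw [← hprod]; ring)

theorem OnNineCycleCurve.left_ne_zero (hC : OnNineCycleCurve a x y) (ha : a ≠ 0)
    (h1 : x + y ≠ -1) (h2 : x + y ≠ -a) : x ≠ 0 := by
  rintro rfl
  have hprod : a * ((0 + y + 1) * (0 + y + a)) = 0 := by
    unfold OnNineCycleCurve at hC
    linear_combination hC
  rcases (mul_eq_zero.1 hprod).resolve_left ha |> mul_eq_zero.1 with h | h
  · exact h1 (eq_neg_of_add_eq_zero_left h)
  · exact h2 (eq_neg_of_add_eq_zero_left h)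

theorem OnNineCycleCurve.add_left_ne_zero (hC : OnNineCycleCurve a x y) (ha : a ≠ 0)
    (ha1 : a ≠ 1) (h1 : x + y ≠ -a) (h2 : x + y ≠ a * (a - 2)) : a + x ≠ 0 := by
  intro hx
  obtain rfl := eq_neg_of_add_eq_zero_right hx
  have hprod : a * (a - 1) * (y * (y - a * (a - 1))) = 0 := by
    unfold OnNineCycleCurve at hC
    linear_combination -hC
  rcases (mul_eq_zero.1 hprod).resolve_left (mul_ne_zero ha (sub_ne_zero.2 ha1))
    |> mul_eq_zero.1 with h | h
  · exact h1 (by rw [h, add_zero])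
  · exact h2 (by linear_combination h)

end nineCycle

/-- The rational points of the cubic `v² = u³ + A u² + P u + R`. -/
def cubicPoints (A P R : ℚ) : Set (ℚ × ℚ) :=
  {c | c.2 ^ 2 = c.1 ^ 3 + A * c.1 ^ 2 + P * c.1 + R}

/-- Duplication on the cubic `v² = u³ + A u² + P u + R` by the tangent construction; the formula
does not involve `R`, and is meaningful only where `v ≠ 0`. -/
def duplicate (A P : ℚ) (c : ℚ × ℚ) : ℚ × ℚ :=
  let t := (3 * c.1 ^ 2 + 2 * A * c.1 + P) / (2 * c.2)
  (t ^ 2 - A - 2 * c.1, -(c.2 + t * (t ^ 2 - A - 2 * c.1 - c.1)))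

section duplicate

variable {A P R : ℚ} {c : ℚ × ℚ}

theorem duplicate_mem_cubicPoints (hc : c ∈ cubicPoints A P R) (h0 : c.2 ≠ 0) :
    duplicate A P c ∈ cubicPoints A P R := by
  obtain ⟨u, v⟩ := c
  obtain ⟨t, ht⟩ : ∃ t, t = (3 * u ^ 2 + 2 * A * u + P) / (2 * v) := ⟨_, rfl⟩
  simp only [cubicPoints, Set.mem_ofPred_eq, duplicate, ← ht] at hc h0 ⊢
  have ht' : 2 * v * t = 3 * u ^ 2 + 2 * A * u + P := by rw [ht]; field_simp
  linear_combination hc + (t ^ 2 - A - 3 * u) * ht'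

theorem duplicate_fst_mul (hc : c ∈ cubicPoints A P R) (h0 : c.2 ≠ 0) :
    (duplicate A P c).1 * (4 * c.2 ^ 2) =
      c.1 ^ 4 + (-2 * P * c.1 ^ 2 + -8 * R * c.1 + (P ^ 2 - 4 * A * R)) := by
  obtain ⟨u, v⟩ := c
  obtain ⟨t, ht⟩ : ∃ t, t = (3 * u ^ 2 + 2 * A * u + P) / (2 * v) := ⟨_, rfl⟩
  simp only [cubicPoints, Set.mem_ofPred_eq, duplicate, ← ht] at hc h0 ⊢
  have ht' : 2 * v * t = 3 * u ^ 2 + 2 * A * u + P := by rw [ht]; field_simp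
  linear_combination (-4 * A - 8 * u) * hc + (2 * v * t + 3 * u ^ 2 + 2 * A * u + P) * ht'

end duplicate

theorem padicNorm_pow_add_quadratic {p : ℕ} [Fact p.Prime] {u : ℚ} (hu : 1 < padicNorm p u)
    {n : ℕ} (hn : 2 < n) (α β γ : ℤ) :
    padicNorm p (u ^ n + (α * u ^ 2 + β * u + γ)) = padicNorm p u ^ n := by
  have hpow : ∀ k, padicNorm p (u ^ k) = padicNorm p u ^ k :=
    IsAbsoluteValue.abv_pow (padicNorm p) u
  have hlt {k : ℕ} (hk : k < n) (z : ℤ) : padicNorm p (z * u ^ k) < padicNorm p u ^ n := calc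
    padicNorm p (z * u ^ k) = padicNorm p z * padicNorm p u ^ k := by rw [padicNorm.mul, hpow]
    _ ≤ 1 * padicNorm p u ^ k := by gcongr; exact padicNorm.of_int z
    _ < padicNorm p u ^ n := by rw [one_mul]; exact pow_lt_pow_right₀ hu hk
  have hadd {r s : ℚ} (hr : padicNorm p r < padicNorm p u ^ n)
      (hs : padicNorm p s < padicNorm p u ^ n) : padicNorm p (r + s) < padicNorm p u ^ n :=
    padicNorm.nonarchimedean.trans_lt (max_lt hr hs)
  have hquad : padicNorm p (α * u ^ 2 + β * u + γ) < padicNorm p u ^ n := by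
    refine hadd (hadd (hlt hn α) ?_) ?_
    · simpa using hlt (k := 1) (by omega) β
    · simpa using hlt (k := 0) (by omega) γ
  rw [padicNorm.add_eq_max_of_ne (by rw [hpow]; exact hquad.ne'), hpow, max_eq_left hquad.le]

section TwoAdic

variable {A P R : ℤ} {c : ℚ × ℚ}

theorem padicNorm_snd_sq {p : ℕ} [Fact p.Prime] (hc : c ∈ cubicPoints A P R)
    (hu : 1 < padicNorm p c.1) : padicNorm p (c.2 ^ 2) = padicNorm p c.1 ^ 3 := by
  rw [show c.2 ^ 2 = c.1 ^ 3 + (A * c.1 ^ 2 + P * c.1 + R) by rw [hc]; ring]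
  exact padicNorm_pow_add_quadratic hu (by norm_num) A P R

theorem snd_ne_zero_of_one_lt_padicNorm {p : ℕ} [Fact p.Prime] (hc : c ∈ cubicPoints A P R)
    (hu : 1 < padicNorm p c.1) : c.2 ≠ 0 := by
  intro h0
  have hsq := padicNorm_snd_sq hc hu
  rw [h0, zero_pow two_ne_zero, padicNorm.zero] at hsq
  exact (pow_pos (zero_lt_one.trans hu) 3).ne hsq

theorem padicNorm_duplicate_fst (hc : c ∈ cubicPoints A P R) (hu : 1 < padicNorm 2 c.1) :
    padicNorm 2 (duplicate A P c).1 = 4 * padicNorm 2 c.1 := by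
  have hfst := congrArg (padicNorm 2)
    (duplicate_fst_mul hc (snd_ne_zero_of_one_lt_padicNorm hc hu))
  have hquad := padicNorm_pow_add_quadratic hu (n := 4) (by norm_num) (-2 * P) (-8 * R)
    (P ^ 2 - 4 * A * R)
  push_cast at hquad
  have h4 : padicNorm 2 4 = 1 / 4 := by
    rw [show (4 : ℚ) = (2 : ℕ) * (2 : ℕ) by norm_num, padicNorm.mul,
      padicNorm.padicNorm_p_of_prime]
    norm_num
  rw [hquad, padicNorm.mul, padicNorm.mul, padicNorm_snd_sq hc hu, h4] at hfst
  refine mul_right_cancel₀ (pow_pos (zero_lt_one.trans hu) 3).ne' ?_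
  linear_combination 4 * hfst

theorem iterate_duplicate_mem (hc : c ∈ cubicPoints A P R) (hu : 1 < padicNorm 2 c.1) (k : ℕ) :
    (duplicate A P)^[k] c ∈ cubicPoints A P R ∧
      padicNorm 2 ((duplicate A P)^[k] c).1 = 4 ^ k * padicNorm 2 c.1 := by
  induction k with
  | zero => exact ⟨hc, by simp⟩
  | succ k ih =>
    obtain ⟨hmem, hnorm⟩ := ih
    have hlt : 1 < padicNorm 2 ((duplicate A P)^[k] c).1 :=
      hnorm ▸ hu.trans_le (le_mul_of_one_le_left (by positivity) (one_le_pow₀ (by norm_num)))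
    rw [Function.iterate_succ_apply', padicNorm_duplicate_fst hmem hlt, hnorm]
    exact ⟨duplicate_mem_cubicPoints hmem (snd_ne_zero_of_one_lt_padicNorm hmem hlt), by ring⟩

/-- Repeated duplication moves a point of the formal group at `2` ever closer to infinity. -/
theorem infinite_one_lt_padicNorm (hc : c ∈ cubicPoints A P R) (hu : 1 < padicNorm 2 c.1) :
    {d ∈ cubicPoints A P R | 1 < padicNorm 2 d.1}.Infinite := by
  refine Set.infinite_of_injective_forall_mem (f := fun k => (duplicate A P)^[k] c)
    (fun k l hkl => ?_) fun k => ?_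
  · have hnorm := congrArg (fun d => padicNorm 2 d.1) hkl
    simp only [(iterate_duplicate_mem hc hu _).2] at hnorm
    exact pow_right_injective₀ (by norm_num) (by norm_num)
      (mul_right_cancel₀ (zero_lt_one.trans hu).ne' hnorm)
  · obtain ⟨hmem, hnorm⟩ := iterate_duplicate_mem hc hu k
    exact ⟨hmem, hnorm ▸ hu.trans_le
      (le_mul_of_one_le_left (by positivity) (one_le_pow₀ (by norm_num)))⟩

end TwoAdic

/-- The inverse of the birational map from `OnNineCycleCurve 9` to the cubic
`v² = u³ + 292465 u² + 11216388096 u + 10764288²` with `u = 10764288 / (9 (x + y) - 503)` and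
`v = 9 u (x - y)`. -/
def ofCubicPoint (c : ℚ × ℚ) : ℚ × ℚ :=
  ((503 * c.1 + 10764288 + c.2) / (18 * c.1), (503 * c.1 + 10764288 - c.2) / (18 * c.1))

section ofCubicPoint

variable {c : ℚ × ℚ}

theorem ofCubicPoint_sum (h0 : c.1 ≠ 0) :
    c.1 * (9 * ((ofCubicPoint c).1 + (ofCubicPoint c).2) - 503) = 10764288 := by
  simp only [ofCubicPoint]
  field_simp
  ring

theorem ofCubicPoint_sub (h0 : c.1 ≠ 0) :
    9 * c.1 * ((ofCubicPoint c).1 - (ofCubicPoint c).2) = c.2 := by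
  simp only [ofCubicPoint]
  field_simp
  ring

theorem injOn_ofCubicPoint : Set.InjOn ofCubicPoint {c | c.1 ≠ 0} := by
  intro c hc d hd hcd
  have hfst : c.1 = d.1 := by
    have hc' := ofCubicPoint_sum hc
    rw [hcd, ← ofCubicPoint_sum hd] at hc'
    have hprod : d.1 * (9 * ((ofCubicPoint d).1 + (ofCubicPoint d).2) - 503) ≠ 0 := by
      rw [ofCubicPoint_sum hd]
      norm_num
    exact mul_right_cancel₀ (right_ne_zero_of_mul hprod) hc'
  refine Prod.ext hfst ?_
  rw [← ofCubicPoint_sub hc, ← ofCubicPoint_sub hd, hcd, hfst]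

theorem onNineCycleCurve_ofCubicPoint (hc : c ∈ cubicPoints 292465 11216388096 (10764288 ^ 2))
    (h0 : c.1 ≠ 0) : OnNineCycleCurve 9 (ofCubicPoint c).1 (ofCubicPoint c).2 := by
  have hc' : c.2 ^ 2 = _ := hc
  simp only [OnNineCycleCurve, ofCubicPoint]
  field_simp
  linear_combination (-193757184) * hc'

theorem cube_ne_nine_mul_eight (q : ℚ) : q ^ 3 ≠ 9 * (9 - 1) := by
  intro hq
  have hval : padicValRat 3 (q ^ 3) = padicValRat 3 ((3 ^ 2 * 8 : ℕ) : ℚ) := by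
    rw [hq]
    norm_num
  rw [padicValRat.pow, padicValRat.of_nat, padicValNat.mul (by norm_num) (by norm_num),
    padicValNat.prime_pow, padicValNat.eq_zero_of_not_dvd (by norm_num : ¬ 3 ∣ 8)] at hval
  push_cast at hval
  omega

theorem ofCubicPoint_mem_lynessPeriodic
    (hc : c ∈ cubicPoints 292465 11216388096 (10764288 ^ 2)) (hu : ∀ z : ℤ, c.1 ≠ z) :
    ofCubicPoint c ∈ lynessPeriodic 9 9 := by
  have h0 : c.1 ≠ 0 := by simpa using hu 0
  have hC := onNineCycleCurve_ofCubicPoint hc h0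
  have hsum := ofCubicPoint_sum h0
  generalize ofCubicPoint c = d at hC hsum ⊢
  obtain ⟨x, y⟩ := d
  have h1 : x + y ≠ -1 := fun h => hu (-21024) (by rw [h] at hsum; push_cast; linarith)
  have h2 : x + y ≠ -9 := fun h => hu (-18432) (by rw [h] at hsum; push_cast; linarith)
  have h3 : x + y ≠ 9 * (9 - 2) := fun h => hu 168192 (by rw [h] at hsum; push_cast; linarith)
  have h9 : (9 : ℚ) ≠ 0 := by norm_num
  have h91 : (9 : ℚ) ≠ 1 := by norm_num
  refine mem_lynessPeriodic_nine hC cube_ne_nine_mul_eight (hC.left_ne_zero h9 h1 h2)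
    (hC.symm.left_ne_zero h9 ?_ ?_) (hC.add_left_ne_zero h9 h91 h2 h3)
    (hC.symm.add_left_ne_zero h9 h91 ?_ ?_) <;> rwa [add_comm]

theorem lynessPeriodic_nine_infinite : (lynessPeriodic 9 9).Infinite := by
  have hmem : ((434354579289 / 1183744, 392787598900794147 / 1287913472) : ℚ × ℚ) ∈
      cubicPoints (292465 : ℤ) (11216388096 : ℤ) (10764288 ^ 2 : ℤ) := by
    norm_num [cubicPoints]
  have hnorm : 1 < padicNorm 2 (434354579289 / 1183744) := by
    by_contra! hle
    have hint : padicNorm 2 (434354579289 : ℤ) < 1 := by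
      calc padicNorm 2 (434354579289 : ℤ)
          = padicNorm 2 (434354579289 / 1183744) * padicNorm 2 (1183744 : ℤ) := by
            rw [← padicNorm.mul]
            norm_num
        _ ≤ 1 * padicNorm 2 (1183744 : ℤ) := by gcongr; exact padicNorm.nonneg _
        _ < 1 := by rw [one_mul, padicNorm.int_lt_one_iff]; norm_num
    rw [padicNorm.int_lt_one_iff] at hint
    norm_num at hint
  have hinf := infinite_one_lt_padicNorm hmem hnorm
  have hint {c : ℚ × ℚ} (hc : 1 < padicNorm 2 c.1) (z : ℤ) : c.1 ≠ z := fun h =>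
    hc.not_ge (h ▸ padicNorm.of_int z)
  push_cast at hinf
  refine Set.infinite_of_injOn_mapsTo (f := ofCubicPoint)
    (injOn_ofCubicPoint.mono fun c hc => by simpa using hint hc.2 0)
    (fun c hc => ofCubicPoint_mem_lynessPeriodic ?_ (hint hc.2)) hinf
  norm_num
  exact hc.1

end ofCubicPoint

theorem legendreSym_natCast_eq_one {p : ℕ} [Fact p.Prime] {m : ℕ} (hm : m ≠ 0)
    (h : ∀ l : ℕ, l.Prime → l ∣ m → legendreSym p l = 1) : legendreSym p m = 1 := by
  induction m using induction_on_primes with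
  | zero => exact absurd rfl hm
  | one => simp
  | prime_mul l n hl ih =>
    rw [Nat.cast_mul, legendreSym.mul, h l hl (dvd_mul_right _ _), one_mul]
    exact ih (right_ne_zero_of_mul hm) fun q hq hqn => h q hq (hqn.mul_left l)

theorem legendreSym_eq_of_dvd_sub {p : ℕ} [Fact p.Prime] {u v : ℤ} (h : (p : ℤ) ∣ u - v) :
    legendreSym p u = legendreSym p v := by
  rw [legendreSym.mod p u, legendreSym.mod p v]
  exact congrArg _ (Int.modEq_iff_dvd.2 h).symm

theorem legendreSym_mul_sq_ne_neg_one {p : ℕ} [Fact p.Prime] {β : ℤ} (hβ : legendreSym p β = 1)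
    (z : ℤ) : legendreSym p (β * z ^ 2) ≠ -1 := by
  rw [legendreSym.mul, hβ, one_mul, pow_two, legendreSym.mul, ← pow_two]
  exact ((sq_nonneg _).trans_lt' neg_one_lt_zero).ne'

theorem legendreSym_eq_one_of_dvd_sq_add {p l : ℕ} [Fact p.Prime] [Fact l.Prime] (hp : p % 4 = 3)
    (hl : l ≠ 2) (hlp : l ≠ p) {u v : ℤ} (hv : ¬ (l : ℤ) ∣ v) (h : (l : ℤ) ∣ u ^ 2 + p * v ^ 2) :
    legendreSym p l = 1 := by
  have hlprime : l.Prime := Fact.out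
  have hneg : legendreSym l (-1 * p) = 1 := by
    have hv0 : (v : ZMod l) ≠ 0 := by rwa [Ne, ZMod.intCast_zmod_eq_zero_iff_dvd]
    have hp0 : ((-1 * p : ℤ) : ZMod l) ≠ 0 := by
      rw [Ne, ZMod.intCast_zmod_eq_zero_iff_dvd, neg_one_mul, dvd_neg, Int.natCast_dvd_natCast]
      exact fun hdvd => hlp ((Nat.prime_dvd_prime_iff_eq hlprime Fact.out).1 hdvd)
    rw [legendreSym.eq_one_iff l hp0]
    refine ⟨u / v, ?_⟩
    rw [← ZMod.intCast_zmod_eq_zero_iff_dvd] at h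
    push_cast at h ⊢
    field_simp
    linear_combination -h
  have hχ : ZMod.χ₄ (l : ZMod 4) ^ (p / 2) = ZMod.χ₄ (l : ZMod 4) := by
    have hodd : Odd (p / 2) := Nat.odd_iff.2 (by omega)
    rcases ZMod.isQuadratic_χ₄ (l : ZMod 4) with h | h | h <;>
      simp [h, hodd.pos.ne', hodd.neg_one_pow]
  rwa [legendreSym.quadratic_reciprocity' hl (by omega : p ≠ 2), pow_mul,
    ← ZMod.χ₄_eq_neg_one_pow (hlprime.eq_two_or_odd.resolve_left hl), hχ,
    ← legendreSym.at_neg_one hl, ← legendreSym.mul]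

theorem exists_mul_sq_of_sq_eq_mul {B T Y : ℤ} (hB : 0 < B) (hY : Y ^ 2 = B * T) :
    ∃ (β : ℕ) (b z : ℤ), β ≠ 0 ∧ B = β * b ^ 2 ∧ T = β * z ^ 2 := by
  lift B to ℕ using hB.le
  obtain ⟨β, b, rfl, hβ⟩ := Nat.sq_mul_squarefree B
  push_cast at hB hY ⊢
  have hb0 : (b : ℤ) ≠ 0 := fun h => by simp [h] at hB
  obtain ⟨y, rfl⟩ : (b : ℤ) ∣ Y :=
    (Int.pow_dvd_pow_iff two_ne_zero).1 (hY ▸ ⟨β * T, by ring⟩)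
  have hy : y ^ 2 = β * T := mul_left_cancel₀ (pow_ne_zero 2 hb0) (by linear_combination hY)
  obtain ⟨z, rfl⟩ : (β : ℤ) ∣ y :=
    (Int.squarefree_natCast.2 hβ).dvd_pow_iff_dvd two_ne_zero |>.1 (hy ▸ dvd_mul_right _ _)
  refine ⟨β, b, z, hβ.ne_zero, by ring, ?_⟩
  exact mul_left_cancel₀ (Nat.cast_ne_zero.2 hβ.ne_zero) (by linear_combination -hy)

instance fact_prime_503 : Fact (Nat.Prime 503) := ⟨by norm_num⟩

section NoPositivePoint

variable {m k B T : ℤ}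

/-- With `B` and `T` as below, `Y ^ 2 ≡ -503 * (18 * k ^ 2) ^ 2` modulo every divisor of `m`. -/
theorem legendreSym_503_eq_one_of_dvd (hk : IsCoprime m k) {Y : ℤ} (hB : B = 503 * k - 9 * m)
    (hT : T = m ^ 2 * B - 36 * k * (m + k) * (m + 9 * k)) (hY : Y ^ 2 = B * T) {d : ℤ}
    (hd : 0 < d) (hdm : d ∣ m) (hd503 : ¬ 503 ∣ d) : legendreSym 503 d = 1 := by
  lift d to ℕ using hd.le
  refine legendreSym_natCast_eq_one (by omega) fun l hl hld => ?_
  have hlm : (l : ℤ) ∣ m := (Int.natCast_dvd_natCast.2 hld).trans hdm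
  have hl503 : l ≠ 503 := by
    rintro rfl
    exact hd503 (Int.natCast_dvd_natCast.2 hld)
  by_cases h2 : l = 2
  · subst h2; norm_num
  by_cases h3 : l = 3
  · subst h3; norm_num
  have : Fact l.Prime := ⟨hl⟩
  have hlp := Nat.prime_iff_prime_int.1 hl
  refine legendreSym_eq_one_of_dvd_sq_add (by norm_num) h2 hl503 (u := Y) (v := 18 * k ^ 2)
    (fun h => ?_) ?_
  · rcases hlp.dvd_or_dvd h with h18 | hk2
    · have h18' : l ∣ 2 * 3 ^ 2 := by exact_mod_cast h18
      rcases hl.dvd_mul.1 h18' with h | h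
      · exact h2 ((Nat.prime_dvd_prime_iff_eq hl Nat.prime_two).1 h)
      · exact h3 ((Nat.prime_dvd_prime_iff_eq hl Nat.prime_three).1 (hl.dvd_of_dvd_pow h))
    · exact hlp.not_isUnit (hk.isUnit_of_dvd' hlm (hlp.dvd_of_dvd_pow hk2))
  · refine hlm.trans ?_
    rw [hY, hT, hB]
    exact ⟨m * (503 * k - 9 * m) ^ 2 - 36 * k * (503 * k * (m + 10 * k) -
      9 * (m + k) * (m + 9 * k)), by push_cast; ring⟩

theorem eq_of_prime_dvd_of_dvd (hk : IsCoprime m k) (hB : B = 503 * k - 9 * m)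
    (hT : T = m ^ 2 * B - 36 * k * (m + k) * (m + 9 * k)) {l : ℕ} (hl : l.Prime)
    (hlB : (l : ℤ) ∣ B) (hlT : (l : ℤ) ∣ T) : l = 2 ∨ l = 3 ∨ l = 73 := by
  have hlp := Nat.prime_iff_prime_int.1 hl
  have hcop : (l : ℤ) ∣ k → ¬ (l : ℤ) ∣ m := fun h1 h2 =>
    hlp.not_isUnit (hk.isUnit_of_dvd' h2 h1)
  have hsmall : (l : ℤ) ∣ 2 ^ 9 * (3 ^ 2 * 73) → l = 2 ∨ l = 3 ∨ l = 73 := fun h => by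
    have h' : l ∣ 2 ^ 9 * (3 ^ 2 * 73) := by exact_mod_cast h
    rcases hl.dvd_mul.1 h' with h | h
    · exact .inl ((Nat.prime_dvd_prime_iff_eq hl Nat.prime_two).1 (hl.dvd_of_dvd_pow h))
    rcases hl.dvd_mul.1 h with h | h
    · exact .inr (.inl ((Nat.prime_dvd_prime_iff_eq hl Nat.prime_three).1 (hl.dvd_of_dvd_pow h)))
    · exact .inr (.inr ((Nat.prime_dvd_prime_iff_eq hl (by norm_num)).1 h))
  have hprod : (l : ℤ) ∣ 36 * k * (m + k) * (m + 9 * k) := by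
    rw [show 36 * k * (m + k) * (m + 9 * k) = m ^ 2 * B - T by rw [hT]; ring]
    exact (hlB.mul_left _).sub hlT
  rcases hlp.dvd_or_dvd hprod with hprod | h9k
  · rcases hlp.dvd_or_dvd hprod with hprod | hmk
    · rcases hlp.dvd_or_dvd hprod with h36 | hlk
      · exact hsmall (h36.trans ⟨2 ^ 7 * 73, by norm_num⟩)
      · have h9m : (l : ℤ) ∣ 9 * m := by
          rw [show 9 * m = 503 * k - B by rw [hB]; ring]
          exact (hlk.mul_left _).sub hlB
        exact hsmall (((hlp.dvd_or_dvd h9m).resolve_right (hcop hlk)).trans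
          ⟨2 ^ 9 * 73, by norm_num⟩)
    · have h512k : (l : ℤ) ∣ 512 * k := by
        rw [show 512 * k = B + 9 * (m + k) by rw [hB]; ring]
        exact hlB.add (hmk.mul_left _)
      exact hsmall (((hlp.dvd_or_dvd h512k).resolve_right fun hlk =>
        hcop hlk ((dvd_add_left hlk).1 hmk)).trans ⟨3 ^ 2 * 73, by norm_num⟩)
  · have h584k : (l : ℤ) ∣ 584 * k := by
      rw [show 584 * k = B + 9 * (m + 9 * k) by rw [hB]; ring]
      exact hlB.add (h9k.mul_left _)
    exact hsmall (((hlp.dvd_or_dvd h584k).resolve_right fun hlk =>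
      hcop hlk ((dvd_add_left (hlk.mul_left 9)).1 h9k)).trans ⟨2 ^ 6 * 3 ^ 2, by norm_num⟩)

/-- `B` and `T` have the same squarefree part `β`, which is a square modulo `503`; reducing `B`
modulo `503` (when `503 ∤ m`) or `T` (when `503 ∣ m`) shows that it is not. -/
theorem sq_ne_mul_of_isCoprime (hm : 0 < m) (hk : IsCoprime m k) (hB : B = 503 * k - 9 * m)
    (hT : T = m ^ 2 * B - 36 * k * (m + k) * (m + 9 * k)) (hB0 : 0 < B) (Y : ℤ) :
    Y ^ 2 ≠ B * T := by
  intro hY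
  obtain ⟨β, b, z, hβ0, hβB, hβT⟩ := exists_mul_sq_of_sq_eq_mul hB0 hY
  have hβl (l : ℕ) (hl : l.Prime) (hlβ : l ∣ β) : l = 2 ∨ l = 3 ∨ l = 73 :=
    have hlβ' : (l : ℤ) ∣ β := Int.natCast_dvd_natCast.2 hlβ
    eq_of_prime_dvd_of_dvd hk hB hT hl (hβB ▸ hlβ'.mul_right _) (hβT ▸ hlβ'.mul_right _)
  have hχβ : legendreSym 503 β = 1 := legendreSym_natCast_eq_one hβ0 fun l hl hlβ => by
    rcases hβl l hl hlβ with rfl | rfl | rfl <;> norm_num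
  have h503 : Prime (503 : ℤ) := by norm_num
  by_cases h : (503 : ℤ) ∣ m
  · obtain ⟨m', rfl⟩ := h
    have hk' : ¬ (503 : ℤ) ∣ k := fun h => h503.not_isUnit (hk.isUnit_of_dvd' (dvd_mul_right _ _) h)
    obtain ⟨c, hc⟩ : (503 : ℤ) ∣ k - 9 * m' := by
      have hb : (503 : ℤ) ∣ β * b ^ 2 := hβB ▸ hB ▸ ⟨k - 9 * m', by ring⟩
      obtain ⟨c, rfl⟩ := h503.dvd_of_dvd_pow ((h503.dvd_or_dvd hb).resolve_left fun hβ => by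
        rcases hβl 503 Fact.out (by exact_mod_cast hβ) with h | h | h <;> omega)
      exact ⟨β * c ^ 2, by linarith⟩
    have hm' : ¬ (503 : ℤ) ∣ m' := fun h => hk' ((dvd_sub_left (h.mul_left 9)).1 ⟨c, hc⟩)
    have hχm := legendreSym_503_eq_one_of_dvd hk hB hT hY (d := m') (by omega)
      (dvd_mul_left _ _) hm'
    refine legendreSym_mul_sq_ne_neg_one hχβ z ?_
    have hdvd : (503 : ℤ) ∣ T - -54 ^ 2 * k ^ 2 * m' :=
      ⟨503 * m' ^ 2 * B - 36 * k * (503 * m' ^ 2 + 10 * k * m') - 324 * k ^ 2 * c, by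
        linear_combination hT - 324 * k ^ 2 * hc⟩
    rw [← hβT, legendreSym_eq_of_dvd_sub hdvd, legendreSym.mul, legendreSym.mul, hχm,
      legendreSym.sq_one' 503 (by rwa [Ne, ZMod.intCast_zmod_eq_zero_iff_dvd])]
    norm_num
  · have hχm := legendreSym_503_eq_one_of_dvd hk hB hT hY hm dvd_rfl h
    refine legendreSym_mul_sq_ne_neg_one hχβ b ?_
    rw [← hβB, legendreSym_eq_of_dvd_sub (v := -9 * m) ⟨k, by rw [hB]; ring⟩, legendreSym.mul, hχm]
    norm_num

end NoPositivePoint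

/-- `x + y = m / k` in lowest terms, and the discriminant of `x`, `y` is a square. -/
theorem OnNineCycleCurve.not_pos {x y : ℚ} (hC : OnNineCycleCurve 9 x y) (hx : 0 < x) :
    ¬ 0 < y := by
  intro hy
  set σ := x + y with hσ
  have hxy : x * y * (503 - 9 * σ) = 9 * (σ + 1) * (σ + 9) := by
    unfold OnNineCycleCurve at hC
    rw [hσ]
    linear_combination -hC
  have hσ0 : 0 < σ := add_pos hx hy
  have hpos : 0 < 503 - 9 * σ :=
    pos_of_mul_pos_right (hxy ▸ by positivity : 0 < x * y * (503 - 9 * σ)) (mul_pos hx hy).le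
  have hnum : σ * σ.den = σ.num := Rat.mul_den_eq_num σ
  have hB0 : 0 < 503 * (σ.den : ℤ) - 9 * σ.num := by
    have hBσ : (0 : ℚ) < (503 - 9 * σ) * σ.den := mul_pos hpos (by exact_mod_cast σ.den_pos)
    rw [sub_mul, mul_assoc 9, hnum] at hBσ
    exact_mod_cast hBσ
  have hsq : IsSquare (((503 * σ.den - 9 * σ.num) * (σ.num ^ 2 * (503 * σ.den - 9 * σ.num) -
      36 * σ.den * (σ.num + σ.den) * (σ.num + 9 * σ.den)) : ℤ) : ℚ) := by
    refine ⟨σ.den * (503 * σ.den - 9 * σ.num) * (x - y), ?_⟩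
    push_cast
    rw [← hnum]
    have hdisc : (x - y) ^ 2 = σ ^ 2 - 4 * (x * y) := by rw [hσ]; ring
    linear_combination (-(σ.den : ℚ) ^ 4 * (503 - 9 * σ) ^ 2) * hdisc +
      (σ.den : ℚ) ^ 4 * 4 * (503 - 9 * σ) * hxy
  obtain ⟨Y, hY⟩ := Rat.isSquare_intCast_iff.1 hsq
  exact sq_ne_mul_of_isCoprime (Rat.num_pos.2 hσ0) (Rat.isCoprime_num_den σ) rfl rfl hB0 Y
    (by rw [hY, pow_two])

/-- For the three residue classes of `i` modulo `3`, the values of this function at the terms `x i`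
of a nine-cycle are the three sums `x i + x (i + 3) + x (i + 6)` minus `a ^ 2 - 4 * a + 1`, and they
are the coordinates of a point on a Hesse cubic. -/
def hesseCoord (a z : ℚ) : ℚ :=
  (z ^ 3 - (a ^ 2 - 4 * a + 1) * z ^ 2 + (a ^ 2 - a + 1) * z - a * (a - 1)) / (z * (a + z))

namespace OnNineCycleCurve

variable {a x y t : ℚ}

theorem add_eq_div (hC : OnNineCycleCurve a x y) (hax : a + x ≠ 0) (hay : a + y ≠ 0)
    (hat : a + t ≠ 0) (ht : t * ((a + x) * (a + y)) = a * (a - 1) * (x * y)) :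
    x + y = (a * (a - 2) * t - a) / (a + t) := by
  unfold OnNineCycleCurve at hC
  rw [eq_div_iff hat]
  refine mul_right_cancel₀ (mul_ne_zero hax hay) ?_
  linear_combination (x + y - a * (a - 2)) * ht + a * hC

theorem mul_eq_div (hC : OnNineCycleCurve a x y) (hax : a + x ≠ 0) (hay : a + y ≠ 0)
    (hat : a + t ≠ 0) (hts : a * (a - 1) - t ≠ 0)
    (ht : t * ((a + x) * (a + y)) = a * (a - 1) * (x * y)) :
    x * y = a * (a * (a - 1)) * t * (t + 1) / ((a + t) * (a * (a - 1) - t)) := by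
  have hadd := (eq_div_iff hat).1 (hC.add_eq_div hax hay hat ht)
  rw [eq_div_iff (mul_ne_zero hat hts)]
  linear_combination -(a + t) * ht + a * t * hadd

theorem sub_ne_zero_of_mul_eq (hC : OnNineCycleCurve a x y) (hax : a + x ≠ 0) (hay : a + y ≠ 0)
    (hat : a + t ≠ 0) (ht0 : t ≠ 0) (ht : t * ((a + x) * (a + y)) = a * (a - 1) * (x * y)) :
    a * (a - 1) - t ≠ 0 := by
  intro hts
  have hadd := (eq_div_iff hat).1 (hC.add_eq_div hax hay hat ht)
  have hprod : a * t * (t * (t + 1)) = 0 := by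
    linear_combination (a + t) * ht - a * t * hadd + ((a + t) * (x * y) - a * t * (t + 1)) * hts
  have hs : 0 < a * (a - 1) + 1 := by nlinarith [sq_nonneg (2 * a - 1)]
  have ha : a ≠ 0 := by
    rintro rfl
    exact ht0 (by linear_combination -hts)
  have ht1 : t + 1 ≠ 0 := by linarith
  exact mul_ne_zero (mul_ne_zero ha ht0) (mul_ne_zero ht0 ht1) hprod

theorem hesseCoord_add (hC : OnNineCycleCurve a x y) (hx : x ≠ 0) (hy : y ≠ 0)
    (hax : a + x ≠ 0) (hay : a + y ≠ 0) (hat : a + t ≠ 0) (ht0 : t ≠ 0)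
    (ht : t * ((a + x) * (a + y)) = a * (a - 1) * (x * y)) :
    a * (hesseCoord a x + hesseCoord a y + hesseCoord a t) = -(a ^ 3 - 6 * a ^ 2 + 3 * a + 1) := by
  have hts := hC.sub_ne_zero_of_mul_eq hax hay hat ht0 ht
  have hS := hC.add_eq_div hax hay hat ht
  have hP := hC.mul_eq_div hax hay hat hts ht
  have hxy := mul_ne_zero hx hy
  have haxy := mul_ne_zero hax hay
  have hs : a * (a - 1) ≠ 0 := fun h => mul_ne_zero ht0 haxy (by rw [ht, h, zero_mul])
  have hadd : hesseCoord a x + hesseCoord a y =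
      t * ((x * y) ^ 2 * (x + y) + a * (x * y) * ((x + y) ^ 2 - 2 * (x * y)) -
        (a ^ 2 - 4 * a + 1) * (2 * (x * y) ^ 2 + a * (x * y) * (x + y)) +
        (a ^ 2 - a + 1) * (x * y) * (x + y + 2 * a) -
        a * (a - 1) * ((x + y) ^ 2 - 2 * (x * y) + a * (x + y))) /
        (a * (a - 1) * (x * y) ^ 2) := by
    rw [pow_two (x * y), ← mul_assoc (a * (a - 1)), ← ht]
    unfold hesseCoord
    field_simp
    ring
  rw [hadd]
  rw [hP] at hxy ⊢
  rw [hS]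
  have ht1 : t + 1 ≠ 0 := fun h => hxy (by rw [h]; ring)
  have ha : a ≠ 0 := left_ne_zero_of_mul hs
  have ha1 : a - 1 ≠ 0 := right_ne_zero_of_mul hs
  unfold hesseCoord
  field_simp
  ring

theorem hesseCoord_mul (hC : OnNineCycleCurve a x y) (hx : x ≠ 0) (hy : y ≠ 0)
    (hax : a + x ≠ 0) (hay : a + y ≠ 0) (hat : a + t ≠ 0) (ht0 : t ≠ 0)
    (ht : t * ((a + x) * (a + y)) = a * (a - 1) * (x * y)) :
    a ^ 2 * (hesseCoord a x * hesseCoord a y * (hesseCoord a t - 3 * (a - 1))) =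
      -(a - 1) * ((a ^ 3 - 6 * a ^ 2 + 3 * a + 1) ^ 2 +
        3 * (a ^ 3 - 6 * a ^ 2 + 3 * a + 1) * (a * hesseCoord a t) +
        3 * (a * hesseCoord a t) ^ 2) := by
  have hts := hC.sub_ne_zero_of_mul_eq hax hay hat ht0 ht
  have hS := hC.add_eq_div hax hay hat ht
  have hP := hC.mul_eq_div hax hay hat hts ht
  have hxy := mul_ne_zero hx hy
  have haxy := mul_ne_zero hax hay
  have hs : a * (a - 1) ≠ 0 := fun h => mul_ne_zero ht0 haxy (by rw [ht, h, zero_mul])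
  have hmul : hesseCoord a x * hesseCoord a y =
      t * ((x * y) ^ 3 - (a ^ 2 - 4 * a + 1) * (x * y) ^ 2 * (x + y) +
        (a ^ 2 - a + 1) * (x * y) * ((x + y) ^ 2 - 2 * (x * y)) -
        a * (a - 1) * ((x + y) ^ 3 - 3 * (x * y) * (x + y)) +
        (a ^ 2 - 4 * a + 1) ^ 2 * (x * y) ^ 2 -
        (a ^ 2 - 4 * a + 1) * (a ^ 2 - a + 1) * (x * y) * (x + y) +
        a * (a - 1) * (a ^ 2 - 4 * a + 1) * ((x + y) ^ 2 - 2 * (x * y)) +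
        (a ^ 2 - a + 1) ^ 2 * (x * y) - a * (a - 1) * (a ^ 2 - a + 1) * (x + y) +
        (a * (a - 1)) ^ 2) / (a * (a - 1) * (x * y) ^ 2) := by
    rw [pow_two (x * y), ← mul_assoc (a * (a - 1)), ← ht]
    unfold hesseCoord
    field_simp
    ring
  rw [hmul]
  rw [hP] at hxy ⊢
  rw [hS]
  have ht1 : t + 1 ≠ 0 := fun h => hxy (by rw [h]; ring)
  have ha : a ≠ 0 := left_ne_zero_of_mul hs
  have ha1 : a - 1 ≠ 0 := right_ne_zero_of_mul hs
  unfold hesseCoord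
  field_simp
  ring

end OnNineCycleCurve

theorem IsLynessSequence.apply_five_mul {a : ℚ} {x : ℕ → ℚ} (h : IsLynessSequence a x)
    (hC : OnNineCycleCurve a (x 0) (x 1)) :
    x 5 * ((a + x 0) * (a + x 1)) = a * (a - 1) * (x 0 * x 1) := by
  have h0 := (h 0).1
  have h1 := (h 1).1
  have h3 := (h 3).1
  have hax := h.add_ne_zero 0
  have h5 := h.mul_eq 3
  unfold OnNineCycleCurve at hC
  refine mul_right_cancel₀ h3 ?_
  rw [mul_right_comm, h5, h.apply_four, h.apply_three]
  field_simp
  linear_combination hC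

theorem add_eq_zero_of_mul_eq_zero_of_cube_add_eq_zero {p q r : ℚ} (h : p * q * r = 0)
    (h3 : p ^ 3 + q ^ 3 + r ^ 3 = 0) : p + q + r = 0 := by
  have hfactor : (p + q + r) * ((p - q) ^ 2 + (q - r) ^ 2 + (r - p) ^ 2) = 0 := by
    linear_combination 2 * h3 - 6 * h
  rcases mul_eq_zero.1 hfactor with hsum | hsq
  · exact hsum
  · have hpq : p = q := by nlinarith [sq_nonneg (p - q), sq_nonneg (q - r), sq_nonneg (r - p)]
    have hqr : q = r := by nlinarith [sq_nonneg (p - q), sq_nonneg (q - r), sq_nonneg (r - p)]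
    subst hpq hqr
    have hp : p = 0 := pow_eq_zero_iff three_ne_zero |>.1 (by linear_combination h)
    rw [hp]
    norm_num

theorem IsLynessSequence.exists_hesse {a : ℚ} {x : ℕ → ℚ} (h : IsLynessSequence a x)
    (hp : HasPeriod x 9) (ha : a ^ 3 - 6 * a ^ 2 + 3 * a + 1 ≠ 0) :
    ∃ p q r : ℚ, p * q * r ≠ 0 ∧
      a * (a - 1) * (p ^ 3 + q ^ 3 + r ^ 3) = (a ^ 3 - 3 * a ^ 2 + 1) * (p * q * r) := by
  have hC := h.onNineCycleCurve hp
  have hx := h.add_apply_zero_ne_zero hp.1.2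
  have h5 := h.apply_five_mul hC
  have hadd := hC.hesseCoord_add (h 0).1 (h 1).1 hx (h.add_ne_zero 0) (h.add_ne_zero 4) (h 5).1 h5
  have hmul := hC.hesseCoord_mul (h 0).1 (h 1).1 hx (h.add_ne_zero 0) (h.add_ne_zero 4) (h 5).1 h5
  have hs : a * (a - 1) ≠ 0 := fun h0 =>
    mul_ne_zero (h 5).1 (mul_ne_zero hx (h.add_ne_zero 0)) (by rw [h5, h0, zero_mul])
  set p := hesseCoord a (x 0)
  set q := hesseCoord a (x 1)
  set r := hesseCoord a (x 5)
  have hcubic : a * (a - 1) * (p ^ 3 + q ^ 3 + r ^ 3) = (a ^ 3 - 3 * a ^ 2 + 1) * (p * q * r) := by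
    have ha0 : a ^ 2 ≠ 0 := pow_ne_zero 2 (left_ne_zero_of_mul hs)
    have hprod : p * q * r =
        -(a - 1) * ((p + q + r) ^ 2 - 3 * (p * q + q * r + r * p)) := by
      rw [show a ^ 3 - 6 * a ^ 2 + 3 * a + 1 = -(a * (p + q + r)) by rw [hadd, neg_neg]] at hmul
      exact mul_left_cancel₀ ha0 (by linear_combination hmul)
    linear_combination a * (p + q + r) * hprod - p * q * r * hadd
  refine ⟨p, q, r, fun h0 => ha ?_, hcubic⟩
  rw [h0, mul_zero] at hcubic
  rw [add_eq_zero_of_mul_eq_zero_of_cube_add_eq_zero h0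
    ((mul_eq_zero.1 hcubic).resolve_left hs), mul_zero] at hadd
  exact neg_eq_zero.1 hadd.symm

/-- Three integers without a common factor, in the form of a Bézout relation. -/
def IsPrimitive (p q r : ℤ) : Prop :=
  ∃ a b c : ℤ, a * p + b * q + c * r = 1

namespace IsPrimitive

variable {p q r : ℤ}

theorem rotate (h : IsPrimitive p q r) : IsPrimitive q r p := by
  obtain ⟨a, b, c, h⟩ := h
  exact ⟨b, c, a, by linear_combination h⟩

theorem of_dvd {r' : ℤ} (h : IsPrimitive p q r) (hr : r' ∣ r) : IsPrimitive p q r' := by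
  obtain ⟨a, b, c, h⟩ := h
  obtain ⟨d, rfl⟩ := hr
  exact ⟨a, b, c * d, by linear_combination h⟩

theorem not_dvd {R : Type*} [CommRing R] {μ : R} (h : IsPrimitive p q r) (hμ : ¬ IsUnit μ)
    (hp : μ ∣ (p : R)) (hq : μ ∣ (q : R)) : ¬ μ ∣ (r : R) := by
  intro hr
  obtain ⟨a, b, c, h⟩ := h
  have hR : (a : R) * p + b * q + c * r = 1 := by
    exact_mod_cast congrArg (Int.cast : ℤ → R) h
  exact hμ (isUnit_of_dvd_one
    (hR ▸ ((hp.mul_left _).add (hq.mul_left _)).add (hr.mul_left _)))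

theorem not_int_dvd {l : ℤ} (h : IsPrimitive p q r) (hl : Prime l) (hp : l ∣ p) (hq : l ∣ q) :
    ¬ l ∣ r := by
  simpa only [Int.cast_id] using h.not_dvd (μ := l) hl.not_isUnit (by simpa) (by simpa)

theorem exists_eq_mul {u v w : ℤ} (h : u * v * w ≠ 0) :
    ∃ d p q r : ℤ, d ≠ 0 ∧ u = d * p ∧ v = d * q ∧ w = d * r ∧ IsPrimitive p q r := by
  obtain ⟨d, hd⟩ := (IsPrincipalIdealRing.principal (Ideal.span {u, v, w})).principal
  have hdvd (t : ℤ) (ht : t ∈ ({u, v, w} : Set ℤ)) : d ∣ t := by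
    rw [← Ideal.mem_span_singleton, Ideal.span, ← hd]
    exact Ideal.subset_span ht
  obtain ⟨p, rfl⟩ := hdvd u (by simp)
  obtain ⟨q, rfl⟩ := hdvd v (by simp)
  obtain ⟨r, rfl⟩ := hdvd w (by simp)
  have hd0 : d ≠ 0 := left_ne_zero_of_mul (left_ne_zero_of_mul (left_ne_zero_of_mul h))
  have hmem : d ∈ Ideal.span {d * p, d * q, d * r} := by
    rw [hd]
    exact Submodule.mem_span_singleton_self d
  obtain ⟨a, t, ht, hat⟩ := Ideal.mem_span_insert.1 hmem
  obtain ⟨b, c, rfl⟩ := Ideal.mem_span_pair.1 ht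
  exact ⟨d, p, q, r, hd0, rfl, rfl, rfl, a, b, c,
    mul_left_cancel₀ hd0 (by linear_combination -hat)⟩

end IsPrimitive

theorem isCoprime_three_iff {t : ℤ} : IsCoprime 3 t ↔ ¬ 3 ∣ t :=
  Int.prime_three.irreducible.coprime_iff_not_dvd

theorem not_three_dvd_of_isCoprime_six {t : ℤ} (h : IsCoprime 6 t) : ¬ 3 ∣ t :=
  isCoprime_three_iff.1 (h.of_isCoprime_of_dvd_left (by norm_num))

/-- The ring of Eisenstein integers `ℤ[ω]` with `ω ^ 2 = -1 - ω`. -/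
abbrev Eisenstein : Type := QuadraticAlgebra ℤ (-1) (-1)

namespace Eisenstein

open QuadraticAlgebra

theorem norm_eq (z : Eisenstein) : z.norm = z.re ^ 2 - z.re * z.im + z.im ^ 2 := by
  rw [norm_def]
  ring

theorem norm_nonneg (z : Eisenstein) : 0 ≤ z.norm := by
  rw [norm_eq]
  nlinarith [sq_nonneg (z.re - z.im), sq_nonneg z.re, sq_nonneg z.im]

theorem norm_eq_zero {z : Eisenstein} : z.norm = 0 ↔ z = 0 := by
  refine ⟨fun h => ?_, fun h => by rw [h, QuadraticAlgebra.norm_zero]⟩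
  rw [norm_eq] at h
  have hre : z.re = 0 := by
    rw [← sq_eq_zero_iff]
    nlinarith [sq_nonneg (z.re - 2 * z.im), sq_nonneg z.re]
  have him : z.im = 0 := by
    rw [← sq_eq_zero_iff]
    nlinarith [sq_nonneg (z.im - 2 * z.re), sq_nonneg z.im]
  ext <;> simpa

theorem norm_pos {z : Eisenstein} (hz : z ≠ 0) : 0 < z.norm :=
  (norm_nonneg z).lt_of_ne' (mt norm_eq_zero.1 hz)

theorem mul_star_self (z : Eisenstein) : z * star z = (z.norm : ℤ) := by
  ext <;> simp [norm_def] <;> ring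

/-- Division of Eisenstein integers with both coordinates rounded to the nearest integer. -/
def quo (z w : Eisenstein) : Eisenstein :=
  ⟨(2 * (z * star w).re + w.norm) / (2 * w.norm), (2 * (z * star w).im + w.norm) / (2 * w.norm)⟩

theorem abs_two_mul_sub_mul_ediv_le (a : ℤ) {m : ℤ} (hm : 0 < m) :
    |2 * (a - m * ((2 * a + m) / (2 * m)))| ≤ m := by
  have hdiv := Int.emod_add_mul_ediv (2 * a + m) (2 * m)
  have hnonneg := Int.emod_nonneg (2 * a + m) (by omega : 2 * m ≠ 0)
  have hlt := Int.emod_lt_of_pos (2 * a + m) (by omega : 0 < 2 * m)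
  rw [abs_le]
  constructor <;> linarith

theorem norm_sub_mul_quo_lt (z : Eisenstein) {w : Eisenstein} (hw : w ≠ 0) :
    (z - w * quo z w).norm < w.norm := by
  have hN := norm_pos hw
  set e : Eisenstein := z * star w - (w.norm : ℤ) * quo z w with he
  have hmul : (z - w * quo z w) * star w = e := by
    rw [he, ← mul_star_self]
    ring
  have hre : |2 * e.re| ≤ w.norm := by
    simpa [he, quo] using abs_two_mul_sub_mul_ediv_le (z * star w).re hN
  have him : |2 * e.im| ≤ w.norm := by
    simpa [he, quo] using abs_two_mul_sub_mul_ediv_le (z * star w).im hN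
  have hlt : e.norm < w.norm * w.norm := by
    rw [norm_eq]
    rw [abs_le] at hre him
    nlinarith
  rw [← hmul, map_mul, QuadraticAlgebra.norm_star] at hlt
  exact lt_of_mul_lt_mul_right hlt hN.le

noncomputable instance : EuclideanDomain Eisenstein :=
  { (inferInstance : CommRing Eisenstein), (inferInstance : Nontrivial Eisenstein) with
    quotient := quo
    remainder := fun z w => z - w * quo z w
    quotient_zero := fun z => by ext <;> simp [quo]
    quotient_mul_add_remainder_eq := fun z w => by ring
    r := fun z w => z.norm.natAbs < w.norm.natAbs
    r_wellFounded := (measure fun z : Eisenstein => z.norm.natAbs).wf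
    remainder_lt := fun z w hw => by
      have hlt := norm_sub_mul_quo_lt z hw
      have hnonneg := norm_nonneg (z - w * quo z w)
      omega
    mul_left_not_lt := fun z w hw => by
      have hpos := norm_pos hw
      rw [map_mul, Int.natAbs_mul, not_lt]
      exact Nat.le_mul_of_pos_right _ (by omega) }

theorem norm_eq_one_of_isUnit {u : Eisenstein} (hu : IsUnit u) : u.norm = 1 :=
  (Int.isUnit_iff.1 (hu.map (QuadraticAlgebra.norm : Eisenstein →* ℤ))).resolve_right fun h => by
    have := norm_nonneg u
    omega

theorem mem_of_isUnit {u : Eisenstein} (hu : IsUnit u) :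
    u ∈ ({1, -1, ⟨0, 1⟩, ⟨0, -1⟩, ⟨1, 1⟩, ⟨-1, -1⟩} : Finset Eisenstein) := by
  have hn := norm_eq_one_of_isUnit hu
  rw [norm_eq] at hn
  have hre : -2 ≤ u.re ∧ u.re ≤ 2 :=
    abs_le_of_sq_le_sq' (by nlinarith [sq_nonneg (u.re - 2 * u.im)]) zero_le_two
  have him : -2 ≤ u.im ∧ u.im ≤ 2 :=
    abs_le_of_sq_le_sq' (by nlinarith [sq_nonneg (u.im - 2 * u.re)]) zero_le_two
  obtain ⟨x, y⟩ := u
  obtain ⟨hre₁, hre₂⟩ := hre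
  obtain ⟨him₁, him₂⟩ := him
  dsimp only at *
  interval_cases x <;> interval_cases y <;> first | decide | omega

theorem prime_of_norm_prime {z : Eisenstein} (hz : Prime z.norm) : Prime z := by
  rw [← irreducible_iff_prime]
  refine ⟨fun h => hz.not_isUnit (h.map (QuadraticAlgebra.norm : Eisenstein →* ℤ)), ?_⟩
  rintro a b rfl
  rw [map_mul] at hz
  exact (hz.irreducible.isUnit_or_isUnit rfl).imp isUnit_iff_norm_isUnit.2
    isUnit_iff_norm_isUnit.2

theorem cube_im (z : Eisenstein) : (z ^ 3).im = 3 * z.re * z.im * (z.re - z.im) := by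
  rw [pow_succ, pow_two]
  simp only [re_mul, im_mul]
  ring

theorem eighteen_dvd_cube_im {z : Eisenstein} (hz : ¬ (3 : ℤ) ∣ z.norm) : 18 ∣ (z ^ 3).im := by
  have h2 : ∀ x y : ZMod 2, x * y * (x - y) = 0 := by decide
  have h3 : ∀ x y : ZMod 3, x ^ 2 - x * y + y ^ 2 ≠ 0 → x * y * (x - y) = 0 := by decide
  rw [cube_im, show 3 * z.re * z.im * (z.re - z.im) = 3 * (z.re * z.im * (z.re - z.im)) by ring]
  refine mul_dvd_mul_left 3 (?_ : (2 * 3 : ℤ) ∣ _)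
  refine IsCoprime.mul_dvd (by norm_num) ?_ ?_
  · rw [← Nat.cast_ofNat, ← ZMod.intCast_zmod_eq_zero_iff_dvd]
    exact_mod_cast h2 z.re z.im
  · rw [← Nat.cast_ofNat, ← ZMod.intCast_zmod_eq_zero_iff_dvd] at hz ⊢
    rw [norm_eq] at hz
    exact_mod_cast h3 z.re z.im (by exact_mod_cast hz)

theorem isCoprime_norm_iff {m : ℤ} {z : Eisenstein} (him : m ∣ z.im) :
    IsCoprime m z.norm ↔ IsCoprime m z.re := by
  obtain ⟨k, hk⟩ := him
  rw [norm_eq, show z.re ^ 2 - z.re * z.im + z.im ^ 2 = z.re ^ 2 + m * (k * (z.im - z.re)) by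
    rw [hk]; ring, IsCoprime.add_mul_left_right_iff, IsCoprime.pow_right_iff two_pos]

theorem isCoprime_intCast {m : ℤ} {z : Eisenstein} (h : IsCoprime m z.norm) :
    IsCoprime z (m : Eisenstein) := by
  have hcast : IsCoprime (m : Eisenstein) (z.norm : Eisenstein) :=
    h.map (Int.castRingHom Eisenstein)
  rw [← mul_star_self] at hcast
  exact hcast.of_mul_right_left.symm

/-- Here `c` collects the factors `π` and `star π`: since `π * star π` is the norm of `π`, up to
powers of this norm a factor `star π` is `π ^ 2` times a cube. -/
theorem exists_eq_mul_isCoprime {π z : Eisenstein} (hπ : Prime π.norm) (hz : z ≠ 0) :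
    ∃ c w : Eisenstein, z = c * w ∧ IsCoprime w c ∧ IsCoprime w (π.norm : Eisenstein) ∧
      ∃ (k a : ℕ) (γ : Eisenstein), a < 3 ∧ (π.norm : Eisenstein) ^ k * c = π ^ a * γ ^ 3 := by
  have hπ₁ := prime_of_norm_prime hπ
  have hπ₂ := prime_of_norm_prime (z := star π) (by rwa [QuadraticAlgebra.norm_star])
  obtain ⟨i, v, hv, rfl⟩ := WfDvdMonoid.max_power_factor hz hπ₁.irreducible
  obtain ⟨j, w, hw, rfl⟩ :=
    WfDvdMonoid.max_power_factor (right_ne_zero_of_mul hz) hπ₂.irreducible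
  have hwπ : IsCoprime w π :=
    (hπ₁.irreducible.coprime_iff_not_dvd.2 fun h => hv (h.mul_left _)).symm
  have hwπ' : IsCoprime w (star π) := (hπ₂.irreducible.coprime_iff_not_dvd.2 hw).symm
  refine ⟨π ^ i * star π ^ j, w, by ring, hwπ.pow_right.mul_right hwπ'.pow_right,
    mul_star_self π ▸ hwπ.mul_right hwπ', 2 * j, (i + 2 * j) % 3,
    π ^ ((i + 2 * j) / 3) * star π ^ j, Nat.mod_lt _ three_pos, ?_⟩
  rw [← mul_star_self]
  calc (π * star π) ^ (2 * j) * (π ^ i * star π ^ j)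
      = π ^ (i + 2 * j) * (star π ^ j) ^ 3 := by ring
    _ = π ^ ((i + 2 * j) % 3 + 3 * ((i + 2 * j) / 3)) * (star π ^ j) ^ 3 := by
      rw [Nat.mod_add_div]
    _ = _ := by rw [pow_add, pow_mul']; ring

theorem isCoprime_norm_of_mul_eq_mul_cube {m M : ℤ} {x y z : Eisenstein}
    (h : (M : Eisenstein) * y = x * z ^ 3) (hM : IsCoprime m M) (hy : IsCoprime m y.norm) :
    IsCoprime m z.norm := by
  rw [← IsCoprime.pow_right_iff (m := 3) three_pos, ← map_pow]
  refine ((hM.pow_right (n := 2)).mul_right hy).of_isCoprime_of_dvd_right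
    (Dvd.intro_left x.norm ?_)
  rw [← map_mul, ← h, map_mul, QuadraticAlgebra.norm_intCast, Int.cast_id]

/-- Modulo `18`, the cube of an Eisenstein integer prime to `6` is a rational integer. -/
theorem dvd_im_of_mul_eq_mul_cube {m M : ℤ} {x y z : Eisenstein} (hm : m ∣ 18)
    (h : (M : Eisenstein) * y = x * z ^ 3) (hM : IsCoprime 6 M) (hy : IsCoprime 6 y.norm)
    (him : m ∣ y.im) : m ∣ x.im := by
  have hcop : IsCoprime 6 z.norm := isCoprime_norm_of_mul_eq_mul_cube h hM hy
  have hz : 18 ∣ (z ^ 3).im := eighteen_dvd_cube_im (not_three_dvd_of_isCoprime_six hcop)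
  have hnorm : IsCoprime 18 (z ^ 3).norm :=
    (map_pow QuadraticAlgebra.norm z 3 ▸ (hcop.pow : IsCoprime (6 ^ 2) (z.norm ^ 3))
      ).of_isCoprime_of_dvd_left (by norm_num)
  have hre := ((isCoprime_norm_iff hz).1 hnorm).of_isCoprime_of_dvd_left hm
  refine hre.dvd_of_dvd_mul_right ?_
  have him' : M * y.im = x.re * (z ^ 3).im + x.im * (z ^ 3).re - x.im * (z ^ 3).im := by
    have himul : M * y.im = (x * z ^ 3).im := by simp [← h]
    rw [himul, im_mul]
    ring
  rw [show x.im * (z ^ 3).re = M * y.im + (x.im - x.re) * (z ^ 3).im by linear_combination -him']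
  exact (him.mul_left _).add ((hm.trans hz).mul_left _)

end Eisenstein

/-- A primitive integral point `(p : q : r)` of the Hesse cubic `s (X³ + Y³ + Z³) = n X Y Z` off the
coordinate lines. -/
structure HessePoint (s n p q r : ℤ) : Prop where
  eq : s * (p ^ 3 + q ^ 3 + r ^ 3) = n * (p * q * r)
  primitive : IsPrimitive p q r
  ne_zero : p * q * r ≠ 0

namespace HessePoint

variable {s n p q r : ℤ}

theorem rotate (h : HessePoint s n p q r) : HessePoint s n q r p :=
  ⟨by linear_combination h.eq, h.primitive.rotate,
    by rw [mul_comm, ← mul_assoc]; exact h.ne_zero⟩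

theorem exists_of_eq {u v w : ℤ} (heq : s * (u ^ 3 + v ^ 3 + w ^ 3) = n * (u * v * w))
    (h0 : u * v * w ≠ 0) :
    ∃ d p q r : ℤ, u = d * p ∧ v = d * q ∧ w = d * r ∧ HessePoint s n p q r := by
  obtain ⟨d, p, q, r, hd, rfl, rfl, rfl, hpqr⟩ := IsPrimitive.exists_eq_mul h0
  refine ⟨d, p, q, r, rfl, rfl, rfl, ?_, hpqr, fun h => h0 (by linear_combination d ^ 3 * h)⟩
  exact mul_left_cancel₀ (pow_ne_zero 3 hd) (by linear_combination heq)

theorem exists_of_rat {p q r : ℚ} (h0 : p * q * r ≠ 0)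
    (heq : (s : ℚ) * (p ^ 3 + q ^ 3 + r ^ 3) = n * (p * q * r)) :
    ∃ u v w : ℤ, HessePoint s n u v w := by
  obtain ⟨⟨t, ht⟩, hint⟩ := IsLocalization.exist_integer_multiples_of_finset
    (nonZeroDivisors ℤ) ({p, q, r} : Finset ℚ)
  have ht0 : (t : ℚ) ≠ 0 := Int.cast_ne_zero.2 (nonZeroDivisors.ne_zero ht)
  obtain ⟨u, hu⟩ := hint p (by simp)
  obtain ⟨v, hv⟩ := hint q (by simp)
  obtain ⟨w, hw⟩ := hint r (by simp)
  simp only [zsmul_eq_mul, eq_intCast] at hu hv hw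
  obtain ⟨-, x, y, z, -, -, -, h⟩ := exists_of_eq (s := s) (n := n) (u := u) (v := v) (w := w)
    (by
      rw [← @Int.cast_inj ℚ]
      push_cast
      rw [hu, hv, hw]
      linear_combination (t : ℚ) ^ 3 * heq)
    (by
      rw [← @Int.cast_ne_zero ℚ]
      push_cast
      rw [hu, hv, hw, show (t * p) * (t * q) * (t * r) = (t : ℚ) ^ 3 * (p * q * r) by ring]
      exact mul_ne_zero (pow_ne_zero 3 ht0) h0)
  exact ⟨x, y, z, h⟩

theorem ne_zero_right (h : HessePoint s n p q r) : r ≠ 0 :=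
  right_ne_zero_of_mul h.ne_zero

end HessePoint

/-- A point `(p : q : d * ρ)` of the Hesse cubic, where `b / ρ` is `3 * s` divided by the third
coordinate in lowest terms. With `(X, Y, Z) = (b * p, b * q, n * ρ)` the cubic becomes
`X³ + Y³ + Z³ - 3 * X * Y * Z = (n³ - 27 * s³) * ρ³`, whose left-hand side splits into linear forms
over the Eisenstein integers. -/
structure ReducedHesse (s n b d p q ρ : ℤ) : Prop extends HessePoint s n p q (d * ρ) where
  mul_eq : b * d = 3 * s
  coprime : IsCoprime b ρ

theorem HessePoint.exists_reducedHesse {s n p q r : ℤ} (h : HessePoint s n p q r) :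
    ∃ b d ρ : ℤ, r = d * ρ ∧ ReducedHesse s n b d p q ρ := by
  obtain ⟨b, ρ, hb, hbs, hr⟩ :=
    Int.exists_gcd_one (Int.gcd_pos_of_ne_zero_right (3 * s) h.ne_zero_right)
  rw [mul_comm] at hr
  exact ⟨b, _, ρ, hr, hr ▸ h, hbs.symm, Int.isCoprime_iff_gcd_eq_one.2 hb⟩

namespace ReducedHesse

open Eisenstein QuadraticAlgebra

variable {s n b d p q ρ : ℤ}

/-- One of the two conjugate linear factors of the Hesse cubic over the Eisenstein integers. -/
def factor (n b p q ρ : ℤ) : Eisenstein := ⟨b * p - n * ρ, b * q - n * ρ⟩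

theorem mul_sum_cubes (h : ReducedHesse s n b d p q ρ) :
    b * (p ^ 3 + q ^ 3 + (d * ρ) ^ 3) = 3 * n * p * q * ρ := by
  have hd : d ≠ 0 := left_ne_zero_of_mul h.ne_zero_right
  apply mul_left_cancel₀ hd
  linear_combination 3 * h.eq + (p ^ 3 + q ^ 3 + (d * ρ) ^ 3) * h.mul_eq

theorem linear_mul_norm_factor (h : ReducedHesse s n b d p q ρ) :
    (b * p + b * q + n * ρ) * (factor n b p q ρ).norm = (n ^ 3 - 27 * s ^ 3) * ρ ^ 3 := by
  rw [norm_eq, factor]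
  linear_combination b ^ 2 * h.mul_sum_cubes -
    ρ ^ 3 * ((b * d) ^ 2 + b * d * (3 * s) + (3 * s) ^ 2) * h.mul_eq

theorem not_dvd_of_dvd {R : Type*} [CommRing R] {μ : R} (h : ReducedHesse s n b d p q ρ)
    (hμ : Prime μ) (hp : μ ∣ ((b * p - n * ρ : ℤ) : R)) (hq : μ ∣ ((b * q - n * ρ : ℤ) : R)) :
    ¬ μ ∣ (ρ : R) := by
  intro hρ
  have hb : ¬ μ ∣ (b : R) := fun hb =>
    hμ.not_isUnit ((h.coprime.map (Int.castRingHom R)).isUnit_of_dvd' hb hρ)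
  push_cast at hp hq
  have hp := (hμ.dvd_or_dvd ((dvd_sub_left (hρ.mul_left _)).1 hp)).resolve_left hb
  have hq := (hμ.dvd_or_dvd ((dvd_sub_left (hρ.mul_left _)).1 hq)).resolve_left hb
  exact (h.primitive.of_dvd (dvd_mul_left ρ d)).not_dvd hμ.not_isUnit hp hq hρ

theorem dvd_of_dvd_factor {μ : Eisenstein} (h : ReducedHesse s n b d p q ρ) (hμ : Prime μ)
    (hμf : μ ∣ factor n b p q ρ) (hμD : ¬ μ ∣ ((n ^ 3 - 27 * s ^ 3 : ℤ) : Eisenstein)) :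
    μ ∣ (ρ : Eisenstein) := by
  have hdvd : μ ∣ (((n ^ 3 - 27 * s ^ 3) * ρ ^ 3 : ℤ) : Eisenstein) := by
    rw [← h.linear_mul_norm_factor, Int.cast_mul, ← mul_star_self]
    exact (hμf.mul_right _).mul_left _
  rw [Int.cast_mul, Int.cast_pow] at hdvd
  exact hμ.dvd_of_dvd_pow ((hμ.dvd_or_dvd hdvd).resolve_left hμD)

theorem isCoprime_cofactors {w : Eisenstein} (h : ReducedHesse s n b d p q ρ)
    (hw : w ∣ factor n b p q ρ) (hw0 : w ≠ 0) (hw3 : IsCoprime w 3)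
    (hwD : IsCoprime w ((n ^ 3 - 27 * s ^ 3 : ℤ) : Eisenstein)) :
    IsCoprime w (star (factor n b p q ρ) * ((b * p + b * q + n * ρ : ℤ) : Eisenstein)) := by
  refine isCoprime_of_prime_dvd (fun h => hw0 h.1) fun μ hμ hμw hcof => ?_
  set f := factor n b p q ρ with hf
  have hμf : μ ∣ f := hμw.trans hw
  have hμρ := h.dvd_of_dvd_factor hμ hμf fun hμD => hμ.not_isUnit (hwD.isUnit_of_dvd' hμw hμD)
  have hμB : μ ∣ 3 * ((b * q - n * ρ : ℤ) : Eisenstein) := by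
    rcases hμ.dvd_or_dvd hcof with hstar | hlin
    · rw [show 3 * ((b * q - n * ρ : ℤ) : Eisenstein) = ⟨-1, -2⟩ * (f - star f) by
        ext <;> simp [hf, factor] <;> ring]
      exact (hμf.sub hstar).mul_left _
    · rw [show 3 * ((b * q - n * ρ : ℤ) : Eisenstein) =
          ⟨2, 1⟩ * (((b * p + b * q + n * ρ : ℤ) : Eisenstein) - f - (3 * n : ℤ) * ρ) by
        ext <;> simp [hf, factor] <;> ring]
      exact ((hlin.sub hμf).sub (hμρ.mul_left _)).mul_left _
  replace hμB := (hμ.dvd_or_dvd hμB).resolve_left fun h3 =>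
    hμ.not_isUnit (hw3.isUnit_of_dvd' hμw h3)
  refine h.not_dvd_of_dvd hμ ?_ hμB hμρ
  rw [show ((b * p - n * ρ : ℤ) : Eisenstein) = f - ((b * q - n * ρ : ℤ) : Eisenstein) * ⟨0, 1⟩ by
    ext <;> simp [hf, factor]]
  exact hμf.sub (hμB.mul_right _)

end ReducedHesse

theorem exists_isUnit_mul_cube {R : Type*} [EuclideanDomain R] {S w D m : R}
    (h : S * w = D * m ^ 3) (hD : D ≠ 0) (hwD : IsCoprime w D) (hwS : IsCoprime w S) :
    ∃ u β : R, IsUnit u ∧ w = u * β ^ 3 := by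
  obtain ⟨k, rfl⟩ : D ∣ S := hwD.symm.dvd_of_dvd_mul_right ⟨m ^ 3, h⟩
  have hwk : w * k = m ^ 3 := mul_left_cancel₀ hD (by linear_combination h)
  obtain ⟨β, u, hu⟩ := exists_associated_pow_of_mul_eq_pow' hwS.of_mul_right_right hwk
  exact ⟨u, β, u.isUnit, by rw [← hu, mul_comm]⟩

namespace ReducedHesse

open Eisenstein QuadraticAlgebra

variable {s n b d p q ρ : ℤ}

theorem factor_ne_zero (h : ReducedHesse s n b d p q ρ) (hD : n ^ 3 - 27 * s ^ 3 ≠ 0) :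
    factor n b p q ρ ≠ 0 := by
  intro h0
  have hzero := h.linear_mul_norm_factor
  rw [h0, QuadraticAlgebra.norm_zero, mul_zero, eq_comm] at hzero
  exact mul_ne_zero hD (pow_ne_zero 3 (right_ne_zero_of_mul h.ne_zero_right)) hzero

theorem exists_eq_isUnit_mul_cube {c w : Eisenstein} (h : ReducedHesse s n b d p q ρ)
    (hcw : factor n b p q ρ = ⟨1, -1⟩ * (c * w)) (hwc : IsCoprime w c)
    (hD : n ^ 3 - 27 * s ^ 3 ≠ 0) (hw3 : IsCoprime w 3)
    (hwD : IsCoprime w ((n ^ 3 - 27 * s ^ 3 : ℤ) : Eisenstein)) :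
    ∃ u β : Eisenstein, IsUnit u ∧ w = u * β ^ 3 := by
  have hf := h.factor_ne_zero hD
  have hwf : w ∣ factor n b p q ρ := hcw ▸ (dvd_mul_left w c).mul_left _
  have hwl : IsCoprime w ⟨1, -1⟩ := hw3.of_isCoprime_of_dvd_right ⟨⟨2, 1⟩, by ext <;> simp⟩
  refine exists_isUnit_mul_cube (m := ρ) ?_ (Int.cast_ne_zero.2 hD) hwD
    ((h.isCoprime_cofactors hwf (ne_zero_of_dvd_ne_zero hf hwf) hw3 hwD).mul_right
      (hwl.mul_right hwc))
  calc star (factor n b p q ρ) * ((b * p + b * q + n * ρ : ℤ) : Eisenstein) * (⟨1, -1⟩ * c) * w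
      = ((b * p + b * q + n * ρ : ℤ) : Eisenstein) *
          (factor n b p q ρ * star (factor n b p q ρ)) := by rw [hcw]; ring
    _ = ((n ^ 3 - 27 * s ^ 3 : ℤ) : Eisenstein) * ρ ^ 3 := by
      rw [mul_star_self]
      exact_mod_cast congrArg (Int.cast : ℤ → Eisenstein) h.linear_mul_norm_factor

theorem dvd_coords_of_dvd_norm_seventeen {z : Eisenstein} (h : 17 ∣ z.norm) :
    17 ∣ z.re ∧ 17 ∣ z.im := by
  have h17 : ∀ x y : ZMod 17, x ^ 2 - x * y + y ^ 2 = 0 → x = 0 ∧ y = 0 := by decide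
  have hcast (x : ℤ) : 17 ∣ x ↔ (x : ZMod 17) = 0 := (ZMod.intCast_zmod_eq_zero_iff_dvd x 17).symm
  rw [norm_eq, hcast] at h
  rw [hcast, hcast]
  exact h17 _ _ (by exact_mod_cast h)

theorem mul_self_eq_one_of_dvd_im_six {u : Eisenstein} (hu : IsUnit u) {a₁ a₂ : ℕ} (ha₁ : a₁ < 3)
    (ha₂ : a₂ < 3) (him : 18 ∣ (u * ⟨5, 6⟩ ^ a₁ * ⟨5, 3⟩ ^ a₂).im) :
    u * u = 1 ∧ a₁ = 0 ∧ a₂ = 0 := by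
  have key : ∀ u ∈ ({1, -1, ⟨0, 1⟩, ⟨0, -1⟩, ⟨1, 1⟩, ⟨-1, -1⟩} : Finset Eisenstein),
      ∀ a₁ < 3, ∀ a₂ < 3, 18 ∣ (u * ⟨5, 6⟩ ^ a₁ * ⟨5, 3⟩ ^ a₂).im →
        u * u = 1 ∧ a₁ = 0 ∧ a₂ = 0 := by decide
  exact key u (mem_of_isUnit hu) a₁ ha₁ a₂ ha₂ him

theorem mul_self_eq_one_of_dvd_im_eight {u : Eisenstein} (hu : IsUnit u) {a : ℕ} (ha : a < 3)
    (him : 6 ∣ (u * ⟨5, 3⟩ ^ a).im) : u * u = 1 ∧ a = 0 := by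
  have key : ∀ u ∈ ({1, -1, ⟨0, 1⟩, ⟨0, -1⟩, ⟨1, 1⟩, ⟨-1, -1⟩} : Finset Eisenstein),
      ∀ a < 3, 6 ∣ (u * ⟨5, 3⟩ ^ a).im → u * u = 1 ∧ a = 0 := by decide
  exact key u (mem_of_isUnit hu) a ha him

theorem exists_mul_eq_cube_six {y : Eisenstein} (h : ReducedHesse 30 109 b d p q ρ)
    (hy : factor 109 b p q ρ = ⟨1, -1⟩ * y) (him : 18 ∣ y.im) (hnorm : IsCoprime 6 y.norm) :
    ∃ (M : ℤ) (β : Eisenstein), IsCoprime 6 M ∧ (M : Eisenstein) * y = β ^ 3 := by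
  have hy0 : y ≠ 0 := right_ne_zero_of_mul (hy ▸ h.factor_ne_zero (by norm_num))
  have hN₁ : (⟨5, 6⟩ : Eisenstein).norm = 31 := by decide
  have hN₂ : (⟨5, 3⟩ : Eisenstein).norm = 19 := by decide
  obtain ⟨c₁, w₁, rfl, hwc₁, hw31, k₁, a₁, γ₁, ha₁, hc₁⟩ :=
    exists_eq_mul_isCoprime (by rw [hN₁]; norm_num) hy0
  obtain ⟨c₂, w, rfl, hwc₂, hw19, k₂, a₂, γ₂, ha₂, hc₂⟩ :=
    exists_eq_mul_isCoprime (by rw [hN₂]; norm_num) (right_ne_zero_of_mul hy0)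
  rw [hN₁] at hw31 hc₁
  rw [hN₂] at hw19 hc₂
  have hw3 : IsCoprime w 3 := (isCoprime_intCast (m := 3) (hnorm.of_isCoprime_of_dvd_left
    (by norm_num))).of_isCoprime_of_dvd_left ((dvd_mul_left w c₂).mul_left c₁)
  replace hwc₁ := hwc₁.of_isCoprime_of_dvd_left (dvd_mul_left w c₂)
  replace hw31 := hw31.of_isCoprime_of_dvd_left (dvd_mul_left w c₂)
  obtain ⟨u, β, hu, rfl⟩ := h.exists_eq_isUnit_mul_cube (hy.trans (by ring))
    (hwc₁.mul_right hwc₂) (by norm_num) hw3 (by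
      rw [show ((109 ^ 3 - 27 * 30 ^ 3 : ℤ) : Eisenstein) = (19 : ℤ) * (31 : ℤ) ^ 3 by norm_num]
      exact hw19.mul_right hw31.pow_right)
  have hM : IsCoprime (6 : ℤ) (31 ^ k₁ * 19 ^ k₂) :=
    (IsCoprime.pow_right (by norm_num)).mul_right (IsCoprime.pow_right (by norm_num))
  have hcube : ((31 ^ k₁ * 19 ^ k₂ : ℤ) : Eisenstein) * (c₁ * (c₂ * (u * β ^ 3))) =
      u * ⟨5, 6⟩ ^ a₁ * ⟨5, 3⟩ ^ a₂ * (γ₁ * γ₂ * β) ^ 3 := by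
    push_cast at hc₁ hc₂ ⊢
    linear_combination u * β ^ 3 * (19 ^ k₂ * c₂ * hc₁ + ⟨5, 6⟩ ^ a₁ * γ₁ ^ 3 * hc₂)
  obtain ⟨huu, rfl, rfl⟩ := mul_self_eq_one_of_dvd_im_six hu ha₁ ha₂
    (dvd_im_of_mul_eq_mul_cube dvd_rfl hcube hM hnorm him)
  exact ⟨_, u * (γ₁ * γ₂ * β), hM,
    hcube.trans (by linear_combination -u * (γ₁ * γ₂ * β) ^ 3 * huu)⟩

theorem not_seventeen_dvd_norm {y : Eisenstein} (h : ReducedHesse 56 321 b d p q ρ)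
    (hy : factor 321 b p q ρ = ⟨1, -1⟩ * y) : ¬ 17 ∣ y.norm := by
  intro h17
  obtain ⟨hre, him⟩ := dvd_coords_of_dvd_norm_seventeen
    (show 17 ∣ (factor 321 b p q ρ).norm by rw [hy, map_mul]; exact h17.mul_left _)
  refine h.not_dvd_of_dvd (R := ℤ) (μ := 17) (by norm_num) hre him ?_
  obtain ⟨A, hA⟩ := hre
  obtain ⟨B, hB⟩ := him
  have hρ := h.linear_mul_norm_factor
  rw [norm_eq, hA, hB] at hρ
  refine Prime.dvd_of_dvd_pow (n := 3) (by norm_num) (IsCoprime.dvd_of_dvd_mul_left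
    (by norm_num : IsCoprime (17 : ℤ) (3 ^ 5 * 19 ^ 3))
    ⟨(b * p + b * q + 321 * ρ) * (A ^ 2 - A * B + B ^ 2), ?_⟩)
  simp only [Int.cast_id]
  linarith

theorem exists_mul_eq_cube_eight {y : Eisenstein} (h : ReducedHesse 56 321 b d p q ρ)
    (hy : factor 321 b p q ρ = ⟨1, -1⟩ * y) (him : 6 ∣ y.im) (hnorm : IsCoprime 6 y.norm) :
    ∃ (M : ℤ) (β : Eisenstein), IsCoprime 6 M ∧ (M : Eisenstein) * y = β ^ 3 := by
  have hy0 : y ≠ 0 := right_ne_zero_of_mul (hy ▸ h.factor_ne_zero (by norm_num))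
  have hN : (⟨5, 3⟩ : Eisenstein).norm = 19 := by decide
  obtain ⟨c, w, rfl, hwc, hw19, k, a, γ, ha, hc⟩ :=
    exists_eq_mul_isCoprime (by rw [hN]; norm_num) hy0
  rw [hN] at hw19 hc
  have hw3 : IsCoprime w 3 := (isCoprime_intCast (m := 3) (hnorm.of_isCoprime_of_dvd_left
    (by norm_num))).of_isCoprime_of_dvd_left (dvd_mul_left w c)
  have h17 : Prime (17 : ℤ) := by norm_num
  have hw17 : IsCoprime w (17 : ℤ) := (isCoprime_intCast (h17.irreducible.coprime_iff_not_dvd.2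
    (h.not_seventeen_dvd_norm hy))).of_isCoprime_of_dvd_left (dvd_mul_left w c)
  obtain ⟨u, β, hu, rfl⟩ := h.exists_eq_isUnit_mul_cube hy hwc (by norm_num) hw3 (by
    rw [show ((321 ^ 3 - 27 * 56 ^ 3 : ℤ) : Eisenstein) = 3 ^ 5 * (17 : ℤ) * (19 : ℤ) ^ 3 by
      norm_num]
    exact (hw3.pow_right.mul_right hw17).mul_right hw19.pow_right)
  have hM : IsCoprime (6 : ℤ) (19 ^ k) := IsCoprime.pow_right (by norm_num)
  have hcube : ((19 ^ k : ℤ) : Eisenstein) * (c * (u * β ^ 3)) =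
      u * ⟨5, 3⟩ ^ a * (γ * β) ^ 3 := by
    push_cast at hc ⊢
    linear_combination u * β ^ 3 * hc
  obtain ⟨huu, rfl⟩ := mul_self_eq_one_of_dvd_im_eight hu ha
    (dvd_im_of_mul_eq_mul_cube (by norm_num) hcube hM hnorm him)
  exact ⟨_, u * (γ * β), hM, hcube.trans (by linear_combination -u * (γ * β) ^ 3 * huu)⟩

end ReducedHesse

theorem mul_sub_cube_eq {R : Type*} [CommRing R] {x y z t : R} (hsum : x + y + z = 3 * t)
    (hprod : x * y * z = t ^ 3) : x * (y - t) ^ 3 = y * (x - t) ^ 3 := by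
  linear_combination (x - y) * hprod - (x - y) * x * y * hsum

theorem pow_eq_pow_of_add_of_mul {F : Type*} [Field F] {e : ℕ}
    (hF : ∀ x : F, x ≠ 0 → x ^ (3 * e) = 1) {x y z t : F} (hsum : x + y + z = 3 * t)
    (hprod : x * y * z = t ^ 3) (hx : x ≠ 0) (hy : y ≠ 0) : x ^ e = y ^ e := by
  have hcube := mul_sub_cube_eq hsum hprod
  by_cases hxt : x = t
  · have hyt : y = t := by simpa [hxt, hxt ▸ hx, sub_eq_zero] using hcube
    rw [hxt, hyt]
  · have hxt' : x - t ≠ 0 := sub_ne_zero.2 hxt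
    have hyt' : y - t ≠ 0 := fun h => mul_ne_zero hy (pow_ne_zero 3 hxt') (by
      rw [← hcube, h]; ring)
    have hpow := congrArg (· ^ e) hcube
    simpa only [mul_pow, ← pow_mul, hF _ hxt', hF _ hyt', mul_one] using hpow

/-- A primitive triple with sum `n * g` and product `(s * g) ^ 3`, such as the cubes of the
coordinates of a `HessePoint s n`. -/
structure PrimitiveTriple (s n g u v w : ℤ) : Prop where
  sum : u + v + w = n * g
  prod : u * v * w = (s * g) ^ 3
  primitive : IsPrimitive u v w
  ne_zero : s * g ≠ 0

namespace PrimitiveTriple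

variable {s n g u v w k l : ℤ}

theorem rotate (h : PrimitiveTriple s n g u v w) : PrimitiveTriple s n g v w u :=
  ⟨by linear_combination h.sum, by linear_combination h.prod, h.primitive.rotate, h.ne_zero⟩

theorem ne_zero_left (h : PrimitiveTriple s n g u v w) : u ≠ 0 :=
  left_ne_zero_of_mul (left_ne_zero_of_mul (h.prod ▸ pow_ne_zero 3 h.ne_zero))

theorem not_dvd (h : PrimitiveTriple s n g u v w) (hl : Prime l) (hu : l ∣ u) (hv : l ∣ v) :
    ¬ l ∣ w ∧ ¬ l ∣ g ∧ l ∣ s := by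
  have hw : ¬ l ∣ w := h.primitive.not_int_dvd hl hu hv
  have hg : ¬ l ∣ g := fun hg => hw (by
    rw [show w = n * g - u - v by linear_combination h.sum]
    exact ((hg.mul_left _).sub hu).sub hv)
  have hsg : l ∣ s * g := hl.dvd_of_dvd_pow (h.prod ▸ (hu.mul_right v).mul_right w)
  exact ⟨hw, hg, (hl.dvd_or_dvd hsg).resolve_right hg⟩

theorem multiplicity_add (h : PrimitiveTriple s n g u v w) (hl : Prime l) :
    multiplicity l u + multiplicity l v + multiplicity l w = 3 * multiplicity l (s * g) := by
  have hfin {t : ℤ} (ht : t ≠ 0) : FiniteMultiplicity l t :=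
    FiniteMultiplicity.of_prime_left hl ht
  have huvw : u * v * w ≠ 0 := h.prod ▸ pow_ne_zero 3 h.ne_zero
  rw [← (hfin h.ne_zero).multiplicity_pow hl, ← h.prod, multiplicity_mul hl (hfin huvw),
    multiplicity_mul hl (hfin (left_ne_zero_of_mul huvw))]

theorem exists_eq_mul_cube (h : PrimitiveTriple s n g u v w) (hk : Prime k) (hl : Prime l)
    (hlk : ¬ l ∣ k) (hs : s ∣ (k * l) ^ 3 * g) :
    ∃ c, u = k ^ multiplicity k u * l ^ multiplicity l u * c ^ 3 := by
  have hu := h.ne_zero_left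
  obtain ⟨x, hx, hkx⟩ := (FiniteMultiplicity.of_prime_left hk hu).exists_eq_pow_mul_and_not_dvd
  have hx0 : x ≠ 0 := right_ne_zero_of_mul (hx ▸ hu)
  obtain ⟨y, hy, hly⟩ := (FiniteMultiplicity.of_prime_left hl hx0).exists_eq_pow_mul_and_not_dvd
  have hmult : multiplicity l u = multiplicity l x := by
    rw [hx, multiplicity_mul hl (hx ▸ FiniteMultiplicity.of_prime_left hl hu),
      multiplicity_eq_zero.2 (mt hl.dvd_of_dvd_pow hlk), zero_add]
  rw [hy, ← hmult] at hx
  set i := multiplicity k u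
  set j := multiplicity l u
  have hyk : IsCoprime y k := (hk.irreducible.coprime_iff_not_dvd.2 fun hky =>
    hkx (hy ▸ hky.mul_left _)).symm
  have hyl : IsCoprime y l := (hl.irreducible.coprime_iff_not_dvd.2 hly).symm
  have hyu : y ∣ u := hx ▸ (dvd_mul_left _ _).mul_left _
  have hy0 : y ≠ 0 := ne_zero_of_dvd_ne_zero hu hyu
  have hshared {μ : ℤ} (hμ : Prime μ) (hμy : μ ∣ y) (hμg : ¬ μ ∣ g) (hμs : μ ∣ s) : False :=
    hμ.not_isUnit ((hyk.mul_right hyl).isUnit_of_dvd' hμy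
      (hμ.dvd_of_dvd_pow ((hμ.dvd_or_dvd (hμs.trans hs)).resolve_right hμg)))
  have hyv : IsCoprime y v := isCoprime_of_prime_dvd (fun h0 => hy0 h0.1) fun μ hμ hμy hμv =>
    (h.not_dvd hμ (hμy.trans hyu) hμv).2.elim (hshared hμ hμy)
  have hyw : IsCoprime y w := isCoprime_of_prime_dvd (fun h0 => hy0 h0.1) fun μ hμ hμy hμw =>
    (h.rotate.rotate.not_dvd hμ hμw (hμy.trans hyu)).2.elim (hshared hμ hμy)
  obtain ⟨ε, β, hε, rfl⟩ := exists_isUnit_mul_cube (S := v * w * (k ^ i * l ^ j)) (D := 1)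
    (m := s * g) (by rw [one_mul, ← h.prod, hx]; ring) one_ne_zero isCoprime_one_right
    ((hyv.mul_right hyw).mul_right (hyk.pow_right.mul_right hyl.pow_right))
  rcases Int.isUnit_iff.1 hε with rfl | rfl
  · exact ⟨β, by rw [hx]; ring⟩
  · exact ⟨-β, by rw [hx]; ring⟩

/-- The cubic residue character `x ↦ x ^ e` sees only the exponent of `l`. -/
theorem three_dvd_multiplicity {R : Type*} [CommRing R] {e m : ℕ}
    (hR : ∀ x : R, IsUnit x → x ^ (3 * e) = 1) (h : PrimitiveTriple s n g u v w) (hk : Prime k)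
    (hl : Prime l) (hlk : ¬ l ∣ k) (hs : s ∣ (k * l) ^ 3 * g)
    (hkR : (k : R) ^ (e * m) = 1) (hku : m ∣ multiplicity k u) (hkv : m ∣ multiplicity k v)
    (hlR : orderOf ((l : R) ^ e) = 3) (hu : IsUnit (u : R)) (hv : IsUnit (v : R))
    (huv : (u : R) ^ e = (v : R) ^ e) :
    3 ∣ multiplicity l u ∧ 3 ∣ multiplicity l v ∧ 3 ∣ multiplicity l w := by
  have hchar {t c : ℤ} (ht : IsUnit (t : R)) (hkt : m ∣ multiplicity k t)
      (htc : t = k ^ multiplicity k t * l ^ multiplicity l t * c ^ 3) :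
      (t : R) ^ e = ((l : R) ^ e) ^ multiplicity l t := by
    have htR : (t : R) = k ^ multiplicity k t * l ^ multiplicity l t * c ^ 3 := by
      exact_mod_cast congrArg (Int.cast : ℤ → R) htc
    have hc : IsUnit (c : R) := isUnit_of_dvd_unit
      (htR ▸ (dvd_pow_self _ three_ne_zero).mul_left _) ht
    obtain ⟨i, hi⟩ := hkt
    calc (t : R) ^ e = (k ^ (e * m)) ^ i * (l ^ e) ^ multiplicity l t * c ^ (3 * e) := by
          rw [htR, hi]; ring
      _ = _ := by rw [hkR, hR _ hc, one_pow, one_mul, mul_one]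
  obtain ⟨c₁, hc₁⟩ := h.exists_eq_mul_cube hk hl hlk hs
  obtain ⟨c₂, hc₂⟩ := h.rotate.exists_eq_mul_cube hk hl hlk hs
  have hmod : multiplicity l u ≡ multiplicity l v [MOD 3] := by
    rw [← hlR, ← (orderOf_pos_iff.1 (hlR ▸ three_pos)).pow_eq_pow_iff_modEq, ← hchar hu hku hc₁,
      ← hchar hv hkv hc₂, huv]
  have hzero : multiplicity l u = 0 ∨ multiplicity l v = 0 ∨ multiplicity l w = 0 := by
    simp only [multiplicity_eq_zero, ← not_and_or]
    exact fun hdvd => (h.not_dvd hl hdvd.1 hdvd.2.1).1 hdvd.2.2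
  have hadd := h.multiplicity_add hl
  unfold Nat.ModEq at hmod
  omega

/-- Modulo `P` the triple has sum `3 * t` and product `t ^ 3` with `t = ζ * s * g`, so any two of
its units have the same cubic residue character. -/
theorem three_dvd_multiplicity_of_zmod {P e m : ℕ} {ζ : ZMod P} (hP : P.Prime) (he : 3 * e = P - 1)
    (hζ : ζ ^ 3 = 1) (hn : (n : ZMod P) = 3 * ζ * s) (hPs : ¬ (P : ℤ) ∣ s)
    (h : PrimitiveTriple s n g u v w) (hk : Prime k) (hl : Prime l) (hlk : ¬ l ∣ k)
    (hs : s ∣ (k * l) ^ 3 * g)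
    (hkP : (k : ZMod P) ^ (e * m) = 1)
    (hkm : m ∣ multiplicity k u ∧ m ∣ multiplicity k v ∧ m ∣ multiplicity k w)
    (hlP : orderOf ((l : ZMod P) ^ e) = 3) :
    3 ∣ multiplicity l u ∧ 3 ∣ multiplicity l v ∧ 3 ∣ multiplicity l w := by
  have : Fact P.Prime := ⟨hP⟩
  have hF (x : ZMod P) (hx : x ≠ 0) : x ^ (3 * e) = 1 := he ▸ ZMod.pow_card_sub_one_eq_one hx
  have hpair {u v w : ℤ} (h : PrimitiveTriple s n g u v w)
      (hku : m ∣ multiplicity k u) (hkv : m ∣ multiplicity k v) (hu : (u : ZMod P) ≠ 0)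
      (hv : (v : ZMod P) ≠ 0) :
      3 ∣ multiplicity l u ∧ 3 ∣ multiplicity l v ∧ 3 ∣ multiplicity l w := by
    have hsum : (u : ZMod P) + v + w = n * g := by exact_mod_cast congrArg Int.cast h.sum
    have hprod : (u : ZMod P) * v * w = (s * g) ^ 3 := by exact_mod_cast congrArg Int.cast h.prod
    exact h.three_dvd_multiplicity (fun x hx => hF x hx.ne_zero) hk hl hlk hs hkP hku hkv hlP
      hu.isUnit hv.isUnit (pow_eq_pow_of_add_of_mul hF (t := ζ * (s * g)) (by rw [hsum, hn]; ring)
        (by linear_combination hprod - (s * g : ZMod P) ^ 3 * hζ) hu hv)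
  have hne {u v w : ℤ} (h : PrimitiveTriple s n g u v w) :
      ¬ ((u : ZMod P) = 0 ∧ (v : ZMod P) = 0) := by
    rw [ZMod.intCast_zmod_eq_zero_iff_dvd, ZMod.intCast_zmod_eq_zero_iff_dvd]
    exact fun h0 => hPs (h.not_dvd (Nat.prime_iff_prime_int.1 hP) h0.1 h0.2).2.2
  obtain ⟨hku, hkv, hkw⟩ := hkm
  by_cases hu : (u : ZMod P) = 0
  · have := hpair h.rotate hkv hkw (fun hv => hne h ⟨hu, hv⟩)
      (fun hw => hne h.rotate.rotate ⟨hw, hu⟩)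
    tauto
  by_cases hv : (v : ZMod P) = 0
  · have := hpair h.rotate.rotate hkw hku (fun hw => hne h.rotate ⟨hv, hw⟩) hu
    tauto
  · exact hpair h hku hkv hu hv

theorem exists_hessePoint (h : PrimitiveTriple s n g u v w) (hk : Prime k) (hl : Prime l)
    (hlk : ¬ l ∣ k) (hs : s ∣ (k * l) ^ 3 * g)
    (hk3 : 3 ∣ multiplicity k u ∧ 3 ∣ multiplicity k v ∧ 3 ∣ multiplicity k w)
    (hl3 : 3 ∣ multiplicity l u ∧ 3 ∣ multiplicity l v ∧ 3 ∣ multiplicity l w) :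
    ∃ x y z : ℤ, HessePoint s n x y z ∧ x * y * z = s * g := by
  have hcube {t c : ℤ} (hkt : 3 ∣ multiplicity k t) (hlt : 3 ∣ multiplicity l t)
      (ht : t = k ^ multiplicity k t * l ^ multiplicity l t * c ^ 3) : ∃ x, t = x ^ 3 := by
    obtain ⟨i, hi⟩ := hkt
    obtain ⟨j, hj⟩ := hlt
    exact ⟨k ^ i * l ^ j * c, by rw [ht, hi, hj]; ring⟩
  obtain ⟨c₁, hc₁⟩ := h.exists_eq_mul_cube hk hl hlk hs
  obtain ⟨c₂, hc₂⟩ := h.rotate.exists_eq_mul_cube hk hl hlk hs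
  obtain ⟨c₃, hc₃⟩ := h.rotate.rotate.exists_eq_mul_cube hk hl hlk hs
  obtain ⟨x, rfl⟩ := hcube hk3.1 hl3.1 hc₁
  obtain ⟨y, rfl⟩ := hcube hk3.2.1 hl3.2.1 hc₂
  obtain ⟨z, rfl⟩ := hcube hk3.2.2 hl3.2.2 hc₃
  have hxyz : x * y * z = s * g :=
    (Odd.strictMono_pow (by decide : Odd 3)).injective (by linear_combination h.prod)
  obtain ⟨a, b, c, habc⟩ := h.primitive
  exact ⟨x, y, z, ⟨by rw [h.sum, hxyz]; ring,
    ⟨a * x ^ 2, b * y ^ 2, c * z ^ 2, by linear_combination habc⟩, hxyz ▸ h.ne_zero⟩, hxyz⟩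

end PrimitiveTriple

namespace PrimitiveTriple

variable {s n g u v w : ℤ}

theorem exists_of_sum_prod (hsn : IsCoprime s n) (hg : s * g ≠ 0) (hsum : u + v + w = n * g)
    (hprod : u * v * w = (s * g) ^ 3) :
    ∃ d g' u' v' w' : ℤ, g = d * g' ∧ u = d * u' ∧ v = d * v' ∧ w = d * w' ∧
      PrimitiveTriple s n g' u' v' w' := by
  obtain ⟨d, u', v', w', hd, rfl, rfl, rfl, hprim⟩ :=
    IsPrimitive.exists_eq_mul (hprod ▸ pow_ne_zero 3 hg : u * v * w ≠ 0)
  have hdn : d ∣ n * g := ⟨u' + v' + w', by linear_combination -hsum⟩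
  have hds : d ∣ s * g := by
    rw [← Int.pow_dvd_pow_iff three_ne_zero, ← hprod]
    exact ⟨u' * v' * w', by ring⟩
  obtain ⟨g', rfl⟩ : d ∣ g := by
    obtain ⟨a, b, hab⟩ := hsn
    rw [show g = a * (s * g) + b * (n * g) by linear_combination -g * hab]
    exact (hds.mul_left _).add (hdn.mul_left _)
  refine ⟨d, g', u', v', w', rfl, rfl, rfl, rfl, ⟨?_, ?_, hprim, fun h0 => hg ?_⟩⟩
  · exact mul_left_cancel₀ hd (by linear_combination hsum)
  · exact mul_left_cancel₀ (pow_ne_zero 3 hd) (by linear_combination hprod)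
  · linear_combination d * h0

theorem three_dvd_multiplicity_five_six (h : PrimitiveTriple 30 109 g u v w) (hg : 3 ∣ g) :
    3 ∣ multiplicity 5 u ∧ 3 ∣ multiplicity 5 v ∧ 3 ∣ multiplicity 5 w :=
  h.three_dvd_multiplicity_of_zmod (P := 31) (e := 10) (m := 1) (ζ := 5) (k := 2)
    (by norm_num) (by norm_num) (by decide) (by decide) (by norm_num) (by norm_num)
    (by norm_num) (by norm_num) (by omega) (by decide) (by simp only [one_dvd, and_self])
    (orderOf_eq_prime (by decide) (by decide))

theorem three_dvd_multiplicity_two_six (h : PrimitiveTriple 30 109 g u v w) (hg : 3 ∣ g) :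
    3 ∣ multiplicity 2 u ∧ 3 ∣ multiplicity 2 v ∧ 3 ∣ multiplicity 2 w :=
  h.three_dvd_multiplicity_of_zmod (P := 19) (e := 6) (m := 3) (ζ := 1) (k := 5)
    (by norm_num) (by norm_num) (by decide) (by decide) (by norm_num) (by norm_num)
    (by norm_num) (by norm_num) (by omega) (by decide) (h.three_dvd_multiplicity_five_six hg)
    (orderOf_eq_prime (by decide) (by decide))

theorem exists_hessePoint_six (h : PrimitiveTriple 30 109 g u v w) (hg : 3 ∣ g) :
    ∃ x y z : ℤ, HessePoint 30 109 x y z ∧ x * y * z = 30 * g :=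
  h.exists_hessePoint (k := 2) (l := 5) (by norm_num) (by norm_num) (by norm_num) (by omega)
    (h.three_dvd_multiplicity_two_six hg) (h.three_dvd_multiplicity_five_six hg)

theorem three_dvd_multiplicity_two_eight (h : PrimitiveTriple 56 321 g u v w) :
    3 ∣ multiplicity 2 u ∧ 3 ∣ multiplicity 2 v ∧ 3 ∣ multiplicity 2 w :=
  h.three_dvd_multiplicity_of_zmod (P := 19) (e := 6) (m := 1) (ζ := 7) (k := 7)
    (by norm_num) (by norm_num) (by decide) (by decide) (by norm_num) (by norm_num)
    (by norm_num) (by norm_num) (by omega) (by decide) (by simp only [one_dvd, and_self])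
    (orderOf_eq_prime (by decide) (by decide))

theorem three_dvd_multiplicity_seven_eight_of_dvd (h : PrimitiveTriple 56 321 g u v w) (hg : 3 ∣ g)
    (hw : 3 ∣ w) : 3 ∣ multiplicity 7 u ∧ 3 ∣ multiplicity 7 v ∧ 3 ∣ multiplicity 7 w := by
  have hunit {t : ℤ} (ht : ¬ 3 ∣ t) : IsUnit (t : ZMod 9) := by
    rw [ZMod.coe_int_isUnit_iff_isCoprime]
    exact (isCoprime_three_iff.2 ht).pow_left (m := 2)
  have hu : ¬ 3 ∣ u := fun hu =>
    absurd (h.rotate.rotate.not_dvd Int.prime_three hw hu).2.2 (by norm_num)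
  have hv : ¬ 3 ∣ v := fun hv => absurd (h.rotate.not_dvd Int.prime_three hv hw).2.2 (by norm_num)
  have hw27 : 3 ^ 3 ∣ w := by
    have huv : IsCoprime (3 ^ 3) (u * v) :=
      ((isCoprime_three_iff.2 hu).mul_right (isCoprime_three_iff.2 hv)).pow_left
    exact huv.dvd_of_dvd_mul_left (h.prod ▸ pow_dvd_pow_of_dvd (hg.mul_left 56) 3)
  have hneg : (u : ZMod 9) = -v := by
    rw [eq_neg_iff_add_eq_zero, ← Int.cast_add, ZMod.intCast_zmod_eq_zero_iff_dvd]
    have := h.sum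
    omega
  obtain ⟨hu2, hv2, -⟩ := h.three_dvd_multiplicity_two_eight
  exact h.three_dvd_multiplicity (R := ZMod 9) (e := 2) (m := 3) (k := 2) (by decide) (by norm_num)
    (by norm_num) (by norm_num) (by omega) (by decide) hu2 hv2
    (orderOf_eq_prime (by decide) (by decide)) (hunit hu) (hunit hv) (by rw [hneg, neg_sq])

theorem three_dvd_multiplicity_seven_eight (h : PrimitiveTriple 56 321 g u v w) (hg : 3 ∣ g) :
    3 ∣ multiplicity 7 u ∧ 3 ∣ multiplicity 7 v ∧ 3 ∣ multiplicity 7 w := by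
  have hprod : 3 ∣ u * v * w := h.prod ▸ dvd_pow (hg.mul_left 56) three_ne_zero
  rcases Int.prime_three.dvd_or_dvd hprod with huv | hw
  · rcases Int.prime_three.dvd_or_dvd huv with hu | hv
    · have := h.rotate.three_dvd_multiplicity_seven_eight_of_dvd hg hu
      tauto
    · have := h.rotate.rotate.three_dvd_multiplicity_seven_eight_of_dvd hg hv
      tauto
  · exact h.three_dvd_multiplicity_seven_eight_of_dvd hg hw

theorem exists_hessePoint_eight (h : PrimitiveTriple 56 321 g u v w) (hg : 3 ∣ g) :
    ∃ x y z : ℤ, HessePoint 56 321 x y z ∧ x * y * z = 56 * g :=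
  h.exists_hessePoint (k := 2) (l := 7) (by norm_num) (by norm_num) (by norm_num) (by omega)
    h.three_dvd_multiplicity_two_eight (h.three_dvd_multiplicity_seven_eight hg)

end PrimitiveTriple

theorem three_dvd_add_of_dvd_add_cubes {p q : ℤ} (h : 3 ∣ p ^ 3 + q ^ 3) : 3 ∣ p + q :=
  Int.prime_three.dvd_of_dvd_pow (n := 3) (by
    rw [show (p + q) ^ 3 = p ^ 3 + q ^ 3 + 3 * (p * q * (p + q)) by ring]
    exact h.add (dvd_mul_right _ _))

namespace ReducedHesse

open Eisenstein QuadraticAlgebra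

variable {s n b d p q ρ : ℤ} {y β : Eisenstein}

theorem mul_eq_of_factor_eq (hy : factor n b p q ρ = ⟨1, -1⟩ * y) :
    b * p = n * ρ + y.re + y.im ∧ b * q = n * ρ + 2 * y.im - y.re := by
  have hre : b * p - n * ρ = y.re + y.im := by simpa [factor] using congrArg re hy
  have him : b * q - n * ρ = y.im + -y.re + y.im := by simpa [factor] using congrArg im hy
  constructor <;> linarith

theorem im_add_mul_norm (h : ReducedHesse s n b d p q ρ) (hy : factor n b p q ρ = ⟨1, -1⟩ * y) :
    9 * (y.im + n * ρ) * y.norm = (n ^ 3 - 27 * s ^ 3) * ρ ^ 3 := by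
  obtain ⟨hbp, hbq⟩ := mul_eq_of_factor_eq hy
  have hnorm : (factor n b p q ρ).norm = 3 * y.norm := by
    rw [hy, map_mul, show (⟨1, -1⟩ : Eisenstein).norm = 3 by decide]
  have hlin := h.linear_mul_norm_factor
  rw [hnorm] at hlin
  linear_combination hlin - 3 * y.norm * (hbp + hbq)

theorem even_im_and_odd_re (h : ReducedHesse s n b d p q ρ)
    (hy : factor n b p q ρ = ⟨1, -1⟩ * y) (hn : Odd n) (hs : Even s) : Even y.im ∧ Odd y.re := by
  have key : ∀ i r ρ : ZMod 2, 9 * (i + 1 * ρ) * (r ^ 2 - r * i + i ^ 2) =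
      (1 ^ 3 - 27 * 0 ^ 3) * ρ ^ 3 → i = 0 ∧ (r = 0 → ρ = 0) := by decide
  have hmod := congrArg (Int.cast : ℤ → ZMod 2) (h.im_add_mul_norm hy)
  rw [norm_eq] at hmod
  push_cast [ZMod.intCast_eq_one_iff_odd.2 hn, ZMod.intCast_eq_zero_iff_even.2 hs] at hmod
  obtain ⟨him, hρ⟩ := key _ _ _ hmod
  rw [ZMod.intCast_eq_zero_iff_even] at him
  rw [ZMod.intCast_eq_zero_iff_even, ZMod.intCast_eq_zero_iff_even] at hρ
  refine ⟨him, Int.not_even_iff_odd.1 fun hre => ?_⟩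
  obtain ⟨hbp, hbq⟩ := mul_eq_of_factor_eq hy
  exact h.not_dvd_of_dvd (R := ℤ) Int.prime_two
    (by rw [Int.cast_id, hbp, add_assoc, add_sub_cancel_left]; exact (hre.add him).two_dvd)
    (by
      rw [Int.cast_id, hbq, add_sub_assoc, add_sub_cancel_left]
      exact ((even_two_mul _).sub hre).two_dvd)
    (hρ hre).two_dvd

theorem three_dvd_add (h : ReducedHesse s n b d p q ρ) (hb : ¬ 3 ∣ b) (hr : 3 ∣ d * ρ) :
    3 ∣ p + q := by
  have hsum : 3 ∣ p ^ 3 + q ^ 3 + (d * ρ) ^ 3 :=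
    (Int.prime_three.dvd_or_dvd ⟨n * p * q * ρ, by linear_combination h.mul_sum_cubes⟩ :
      3 ∣ b ∨ _).resolve_left hb
  exact three_dvd_add_of_dvd_add_cubes ((dvd_add_left (dvd_pow hr three_ne_zero)).1 hsum)

theorem not_three_dvd_left (h : ReducedHesse s n b d p q ρ) (hb : ¬ 3 ∣ b) (hr : 3 ∣ d * ρ) :
    ¬ 3 ∣ p := fun hp =>
  h.primitive.not_int_dvd Int.prime_three hp ((dvd_add_right hp).1 (h.three_dvd_add hb hr)) hr

theorem exists_im_eq {r κ : ℤ} (h : ReducedHesse s n b d p q ρ)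
    (hy : factor n b p q ρ = ⟨1, -1⟩ * y) (hb : ¬ 3 ∣ b) (hr : d * ρ = 3 * r)
    (hκ : n * ρ = 3 * κ) : ∃ t, y.im = 3 * t ∧ 3 ∣ t + b * r := by
  obtain ⟨hbp, hbq⟩ := mul_eq_of_factor_eq hy
  obtain ⟨e, he⟩ := h.three_dvd_add hb ⟨r, hr⟩
  have hp := h.not_three_dvd_left hb ⟨r, hr⟩
  have hq : ¬ 3 ∣ q := fun hq => hp ((dvd_add_left hq).1 ⟨e, he⟩)
  have hkey : p * q * (b * e + κ) = 3 * (b * (e ^ 3 + r ^ 3)) := by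
    have hcubes := h.mul_sum_cubes
    rw [hr, show 3 * n * p * q * ρ = 3 * p * q * (n * ρ) by ring, hκ] at hcubes
    have h9 : 9 * (p * q * (b * e + κ)) = 9 * (3 * (b * (e ^ 3 + r ^ 3))) := by
      linear_combination -hcubes + b * ((p + q) ^ 2 + (p + q) * (3 * e) + 9 * e ^ 2) * he -
        3 * b * p * q * he
    linarith
  obtain ⟨f, hf⟩ : 3 ∣ b * e + κ := by
    refine (Int.prime_three.dvd_or_dvd ⟨_, hkey⟩).resolve_left fun hpq => ?_
    exact (Int.prime_three.dvd_or_dvd hpq).elim hp hq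
  have him : y.im = b * e - 2 * κ := by linarith [congrArg (b * ·) he]
  refine ⟨f - κ, by linarith, ?_⟩
  have hpqf : p * q * f = b * (e ^ 3 + r ^ 3) := by
    rw [hf] at hkey
    linarith
  rw [← Nat.cast_ofNat (R := ℤ), ← ZMod.intCast_zmod_eq_zero_iff_dvd] at hp ⊢
  have hp2 : ∀ x : ZMod 3, x ≠ 0 → x ^ 2 = 1 := by decide
  have h3 : (3 : ZMod 3) = 0 := rfl
  have he' := congrArg (Int.cast : ℤ → ZMod 3) he
  have hf' := congrArg (Int.cast : ℤ → ZMod 3) hf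
  have hpqf' := congrArg (Int.cast : ℤ → ZMod 3) hpqf
  push_cast [h3, ZMod.pow_card] at he' hf' hpqf' ⊢
  linear_combination (p * f : ZMod 3) * he' - hpqf' - f * hp2 _ hp - hf'

theorem exists_factor_eq (h : ReducedHesse s n b d p q ρ) (hb : ¬ 3 ∣ b) (hr : 3 ∣ d * ρ)
    (hn : 3 ∣ n * ρ) : ∃ y, factor n b p q ρ = ⟨1, -1⟩ * y := by
  obtain ⟨e, he⟩ := h.three_dvd_add hb hr
  obtain ⟨κ, hκ⟩ := hn
  obtain rfl : q = 3 * e - p := by linarith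
  refine ⟨⟨b * p - κ - b * e, b * e - 2 * κ⟩, ?_⟩
  rw [factor, hκ]
  ext <;> simp <;> ring

theorem six_dvd_im_and_isCoprime_norm (h : ReducedHesse s n b d p q ρ)
    (hy : factor n b p q ρ = ⟨1, -1⟩ * y) (hb : ¬ 3 ∣ b) (hr : 3 ∣ d * ρ) (hκ : 3 ∣ n * ρ)
    (hn : Odd n) (hs : Even s) : 6 ∣ y.im ∧ IsCoprime 6 y.norm := by
  obtain ⟨r, hr'⟩ := hr
  obtain ⟨κ, hκ'⟩ := hκ
  obtain ⟨t, ht, -⟩ := h.exists_im_eq hy hb hr' hκ'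
  obtain ⟨him, hre⟩ := h.even_im_and_odd_re hy hn hs
  have hdvd : 6 ∣ y.im := by
    have := him.two_dvd
    omega
  have hre3 : ¬ 3 ∣ y.re := fun hre3 => by
    have hbp : 3 ∣ b * p := by
      rw [(mul_eq_of_factor_eq hy).1, hκ', ht]
      exact ((dvd_mul_right _ _).add hre3).add (dvd_mul_right _ _)
    exact (Int.prime_three.dvd_or_dvd hbp).elim hb (h.not_three_dvd_left hb ⟨r, hr'⟩)
  refine ⟨hdvd, (isCoprime_norm_iff hdvd).2 (?_ : IsCoprime (2 * 3) y.re)⟩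
  exact (Int.isCoprime_two_left.2 hre).mul_left (isCoprime_three_iff.2 hre3)

theorem prod_eq {M t : ℤ} (h : ReducedHesse s n b d p q ρ)
    (hy : factor n b p q ρ = ⟨1, -1⟩ * y) (hβ : (M : Eisenstein) * y = β ^ 3)
    (ht : n * (M * ρ) = 3 * t) :
    (t + β.norm * β.im) * (t + β.norm * (β.re - β.im)) * (t - β.norm * β.re) =
      (s * (M * ρ)) ^ 3 := by
  have hnorm : M ^ 2 * y.norm = β.norm ^ 3 := by
    simpa using congrArg QuadraticAlgebra.norm hβ
  have him : M * y.im = 3 * β.re * β.im * (β.re - β.im) := by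
    rw [← cube_im, ← hβ]
    simp
  have hN := norm_eq β
  apply mul_left_cancel₀ (by norm_num : (27 : ℤ) ≠ 0)
  linear_combination 27 * t * β.norm ^ 2 * hN +
    (9 * β.norm ^ 3 - ((n * (M * ρ)) ^ 2 + n * (M * ρ) * (3 * t) + (3 * t) ^ 2)) * ht +
    9 * (M * y.im + n * (M * ρ)) * hnorm + 9 * β.norm ^ 3 * him - M ^ 3 * h.im_add_mul_norm hy

theorem exists_primitiveTriple {M : ℤ} (h : ReducedHesse s n b d p q ρ) (hsn : IsCoprime s n)
    (hs : s ≠ 0) (hρ : 3 ∣ ρ) (hy : factor n b p q ρ = ⟨1, -1⟩ * y) (hnorm : ¬ 3 ∣ y.norm)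
    (hM : ¬ 3 ∣ M) (hβ : (M : Eisenstein) * y = β ^ 3) :
    ∃ g u v w : ℤ, PrimitiveTriple s n g u v w ∧ 3 ∣ g ∧ g ∣ M * ρ := by
  have hMρ : 3 ∣ M * ρ := hρ.mul_left M
  obtain ⟨t, ht⟩ : 3 ∣ n * (M * ρ) := hMρ.mul_left n
  have hM0 : M ≠ 0 := fun h0 => hM (h0 ▸ dvd_zero 3)
  have hρ0 : ρ ≠ 0 := right_ne_zero_of_mul h.ne_zero_right
  have hN : ¬ 3 ∣ β.norm := isCoprime_three_iff.1 (isCoprime_norm_of_mul_eq_mul_cube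
    (hβ.trans (one_mul _).symm) (isCoprime_three_iff.2 hM) (isCoprime_three_iff.2 hnorm))
  obtain ⟨e, g, u, v, w, hg, hu, -, hw, htriple⟩ := PrimitiveTriple.exists_of_sum_prod hsn
    (mul_ne_zero hs (mul_ne_zero hM0 hρ0)) (by linear_combination -ht) (h.prod_eq hy hβ ht)
  refine ⟨g, u, v, w, htriple, ?_, hg ▸ dvd_mul_left g e⟩
  refine (Int.prime_three.dvd_or_dvd (hg ▸ hMρ)).resolve_left fun he => ?_
  obtain ⟨f, hf⟩ : 3 ∣ β.re + β.im := by
    refine (Int.prime_three.dvd_or_dvd (?_ : 3 ∣ β.norm * (β.re + β.im))).resolve_left hN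
    rw [show β.norm * (β.re + β.im) = e * (u - w) by linear_combination hu - hw]
    exact he.mul_right _
  refine hN ⟨3 * f ^ 2 - β.re * β.im, ?_⟩
  rw [norm_eq]
  linear_combination (β.re + β.im + 3 * f) * hf

end ReducedHesse

namespace HessePoint

variable {s n p q r : ℤ}

theorem not_three_dvd (h : HessePoint s n p q r) (hs : ¬ 9 ∣ s) (hr : 3 ∣ r) : ¬ 3 ∣ p := by
  intro hp
  have hq : ¬ 3 ∣ q := h.rotate.rotate.primitive.not_int_dvd Int.prime_three hr hp
  obtain ⟨p, rfl⟩ := hp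
  obtain ⟨r, rfl⟩ := hr
  have hsq : 3 ^ 2 ∣ q ^ 3 * s :=
    ⟨n * p * q * r - 3 * s * (p ^ 3 + r ^ 3), by linear_combination h.eq⟩
  exact hs ((isCoprime_three_iff.2 hq).pow.dvd_of_dvd_mul_left hsq)

theorem exists_three_pow_dvd (h : HessePoint s n p q r) (hs : ¬ 9 ∣ s) (h3 : 3 ∣ p * q * r) :
    ∃ p' q' r', HessePoint s n p' q' r' ∧ r' ∣ p * q * r ∧ ∀ k, 3 ^ k ∣ p * q * r → 3 ^ k ∣ r' := by
  have hright {p q r : ℤ} (h : HessePoint s n p q r) (hr : 3 ∣ r) (k : ℕ)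
      (hk : 3 ^ k ∣ p * q * r) : 3 ^ k ∣ r := by
    have hp : ¬ 3 ∣ p := h.not_three_dvd hs hr
    have hq : ¬ 3 ∣ q := fun hq => h.rotate.rotate.not_three_dvd hs hq hr
    exact ((isCoprime_three_iff.2 hp).mul_right
      (isCoprime_three_iff.2 hq)).pow_left.dvd_of_dvd_mul_left hk
  rcases Int.prime_three.dvd_or_dvd h3 with hpq | hr
  · have hqrp : q * r * p = p * q * r := by ring
    have hrpq : r * p * q = p * q * r := by ring
    rcases Int.prime_three.dvd_or_dvd hpq with hp | hq
    · exact ⟨q, r, p, h.rotate, hqrp ▸ dvd_mul_left p (q * r), hqrp ▸ hright h.rotate hp⟩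
    · exact ⟨r, p, q, h.rotate.rotate, hrpq ▸ dvd_mul_left q (r * p),
        hrpq ▸ hright h.rotate.rotate hq⟩
  · exact ⟨p, q, r, h, dvd_mul_left r (p * q), hright h hr⟩

theorem false_of_descent {m : ℤ}
    (hdesc : ∀ p q r, HessePoint s n p q r → m ∣ r →
      ∃ p' q' r', HessePoint s n p' q' r' ∧ m ∣ r' ∧ ∀ k, 3 ^ k ∣ r' → 3 ^ (k + 1) ∣ r)
    (h : HessePoint s n p q r) (hr : m ∣ r) : False := by
  have hpow (k : ℕ) : ∀ p q r, HessePoint s n p q r → m ∣ r → 3 ^ k ∣ r := by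
    induction k with
    | zero => exact fun p q r _ _ => by simp
    | succ k ih =>
      intro p q r h hr
      obtain ⟨p', q', r', h', hr', hk⟩ := hdesc p q r h hr
      exact hk k (ih p' q' r' h' hr')
  obtain ⟨k, hk⟩ := FiniteMultiplicity.of_prime_left Int.prime_three h.ne_zero_right
  exact hk (hpow (k + 1) p q r h hr)

end HessePoint

namespace ReducedHesse

open Eisenstein

variable {s n b d p q ρ : ℤ}

theorem exists_descent {M : ℤ} {y β : Eisenstein} (h : ReducedHesse s n b d p q ρ)
    (hsn : IsCoprime s n) (hs : ¬ 9 ∣ s)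
    (hcubes : ∀ {g u v w : ℤ}, PrimitiveTriple s n g u v w → 3 ∣ g →
      ∃ x y z : ℤ, HessePoint s n x y z ∧ x * y * z = s * g)
    (hb : ¬ 3 ∣ b) (hρ : 3 ∣ ρ) (hy : factor n b p q ρ = ⟨1, -1⟩ * y)
    (hnorm : ¬ 3 ∣ y.norm) (hM : ¬ 3 ∣ M) (hβ : (M : Eisenstein) * y = β ^ 3) :
    ∃ p' q' r' : ℤ, HessePoint s n p' q' r' ∧ (∀ k, 3 ^ k ∣ 3 * s → 3 ^ k ∣ r') ∧
      ∀ k, 3 ^ k ∣ r' → 3 ^ (k + 1) ∣ d * ρ := by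
  have hs0 : s ≠ 0 := fun h0 => hs (h0 ▸ dvd_zero 9)
  obtain ⟨g, u, v, w, htriple, hg, hgρ⟩ :=
    h.exists_primitiveTriple hsn hs0 hρ hy hnorm hM hβ
  obtain ⟨x, y, z, hxyz, hprod⟩ := hcubes htriple hg
  have hsg : 3 * s ∣ s * g := mul_comm s 3 ▸ mul_dvd_mul_left s hg
  obtain ⟨p', q', r', h', hr', hpow⟩ :=
    hxyz.exists_three_pow_dvd hs (hprod ▸ hg.mul_left s)
  rw [hprod] at hr' hpow
  refine ⟨p', q', r', h', fun k hk => hpow k (hk.trans hsg), fun k hk => ?_⟩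
  have hMb : ¬ 3 ∣ M * b := fun h3 => (Int.prime_three.dvd_or_dvd h3).elim hM hb
  refine (isCoprime_three_iff.2 hMb).pow_left.dvd_of_dvd_mul_left ?_
  rw [show M * b * (d * ρ) = s * (M * ρ) * 3 by linear_combination M * ρ * h.mul_eq, pow_succ]
  exact mul_dvd_mul_right ((hk.trans hr').trans (mul_dvd_mul_left s hgρ)) 3

theorem exists_descent_six (h : ReducedHesse 30 109 b d p q ρ) (hb : ¬ 3 ∣ b) (hρ : 3 ∣ ρ) :
    ∃ p' q' r' : ℤ, HessePoint 30 109 p' q' r' ∧ 9 ∣ r' ∧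
      ∀ k, 3 ^ k ∣ r' → 3 ^ (k + 1) ∣ d * ρ := by
  obtain ⟨y, hy⟩ := h.exists_factor_eq hb (hρ.mul_left d) (hρ.mul_left 109)
  obtain ⟨him, hnorm⟩ := h.six_dvd_im_and_isCoprime_norm hy hb (hρ.mul_left d) (hρ.mul_left 109)
    (by decide) (by decide)
  have hd : 3 ∣ d :=
    (Int.prime_three.dvd_or_dvd ⟨30, h.mul_eq⟩).resolve_left hb
  have him18 : 18 ∣ y.im := by
    obtain ⟨κ, rfl⟩ := hρ
    obtain ⟨t, ht, htb⟩ := h.exists_im_eq hy hb (mul_left_comm d 3 κ) (mul_left_comm 109 3 κ)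
    rw [dvd_add_left ((hd.mul_right κ).mul_left b)] at htb
    omega
  obtain ⟨M, β, hM, hβ⟩ := h.exists_mul_eq_cube_six hy him18 hnorm
  obtain ⟨p', q', r', h', h9, hk⟩ := h.exists_descent (by norm_num) (by norm_num)
    PrimitiveTriple.exists_hessePoint_six hb hρ hy
    (not_three_dvd_of_isCoprime_six hnorm) (not_three_dvd_of_isCoprime_six hM) hβ
  exact ⟨p', q', r', h', h9 2 (by norm_num), hk⟩

theorem exists_descent_eight (h : ReducedHesse 56 321 b d p q ρ) (hb : ¬ 3 ∣ b) :
    ∃ p' q' r' : ℤ, HessePoint 56 321 p' q' r' ∧ 3 ∣ r' ∧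
      ∀ k, 3 ^ k ∣ r' → 3 ^ (k + 1) ∣ d * ρ := by
  obtain ⟨d, rfl⟩ : 3 ∣ d := (Int.prime_three.dvd_or_dvd ⟨56, h.mul_eq⟩).resolve_left hb
  have hr : 3 ∣ 3 * d * ρ := (dvd_mul_right 3 d).mul_right ρ
  have hκ : 321 * ρ = 3 * (107 * ρ) := by ring
  obtain ⟨y, hy⟩ := h.exists_factor_eq hb hr ⟨_, hκ⟩
  obtain ⟨him, hnorm⟩ := h.six_dvd_im_and_isCoprime_norm hy hb hr ⟨_, hκ⟩ (by decide) (by decide)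
  obtain ⟨M, β, hM, hβ⟩ := h.exists_mul_eq_cube_eight hy him hnorm
  have hρ : 3 ∣ ρ := by
    obtain ⟨t, ht, htb⟩ := h.exists_im_eq hy hb (mul_assoc 3 d ρ) hκ
    have hβ18 : 18 ∣ M * y.im := by
      rw [show M * y.im = (β ^ 3).im by simp [← hβ]]
      exact eighteen_dvd_cube_im (not_three_dvd_of_isCoprime_six
        (isCoprime_norm_of_mul_eq_mul_cube (hβ.trans (one_mul _).symm) hM hnorm))
    have ht3 : 3 ∣ t := by
      refine (Int.prime_three.dvd_or_dvd (?_ : 3 ∣ M * t)).resolve_left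
        (not_three_dvd_of_isCoprime_six hM)
      rw [ht, mul_left_comm] at hβ18
      omega
    rw [dvd_add_right ht3] at htb
    have hbd : b * d = 56 := by linarith [h.mul_eq]
    rw [← mul_assoc, hbd] at htb
    exact (Int.prime_three.dvd_or_dvd htb).resolve_left (by norm_num)
  obtain ⟨p', q', r', h', h3, hk⟩ := h.exists_descent (by norm_num) (by norm_num)
    PrimitiveTriple.exists_hessePoint_eight hb hρ hy
    (not_three_dvd_of_isCoprime_six hnorm) (not_three_dvd_of_isCoprime_six hM) hβ
  exact ⟨p', q', r', h', h3 1 (by norm_num), hk⟩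

end ReducedHesse

namespace HessePoint

variable {s n p q r : ℤ}

theorem twentySeven_dvd_six (h : HessePoint 30 109 p q r) (hr : 9 ∣ r) : 27 ∣ r := by
  have hr3 : 3 ∣ r := (by norm_num : (3 : ℤ) ∣ 9).trans hr
  have hp := h.not_three_dvd (by norm_num) hr3
  have hq : ¬ 3 ∣ q := fun hq => h.rotate.rotate.not_three_dvd (by norm_num) hq hr3
  obtain ⟨e, he⟩ : 3 ∣ p + q := three_dvd_add_of_dvd_add_cubes (by
    have h27 : 3 ∣ r ^ 3 := dvd_pow hr3 three_ne_zero
    have heq := h.eq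
    have h9 : 9 ∣ p * q * r := hr.mul_left _
    omega)
  have hcop : IsCoprime (3 ^ 3) (109 * (p * q)) := IsCoprime.pow_left <|
    (by norm_num : IsCoprime (3 : ℤ) 109).mul_right <|
      (isCoprime_three_iff.2 hp).mul_right (isCoprime_three_iff.2 hq)
  refine hcop.dvd_of_dvd_mul_left ?_
  obtain ⟨r, rfl⟩ := hr3
  exact ⟨30 * (e ^ 3 + r ^ 3) - 10 * p * q * e, by
    linear_combination -h.eq + 30 * ((p + q) ^ 2 + (p + q) * (3 * e) + 9 * e ^ 2) * he -
      90 * p * q * he⟩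

theorem exists_descent_six (h : HessePoint 30 109 p q r) (hr : 9 ∣ r) :
    ∃ p' q' r', HessePoint 30 109 p' q' r' ∧ 9 ∣ r' ∧ ∀ k, 3 ^ k ∣ r' → 3 ^ (k + 1) ∣ r := by
  have h27 := h.twentySeven_dvd_six hr
  obtain ⟨b, d, ρ, rfl, hred⟩ := h.exists_reducedHesse
  have hρ : 3 ∣ ρ := by
    by_contra hρ
    have hd : 3 ^ 3 ∣ d := (isCoprime_three_iff.2 hρ).pow_left.dvd_of_dvd_mul_right h27
    exact absurd (hd.trans ⟨b, by linear_combination -hred.mul_eq⟩ : 3 ^ 3 ∣ 3 * (30 : ℤ))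
      (by norm_num)
  exact hred.exists_descent_six (fun hb => Int.prime_three.not_isUnit
    (hred.coprime.isUnit_of_dvd' hb hρ)) hρ

theorem exists_descent_eight (h : HessePoint 56 321 p q r) (hr : 3 ∣ r) :
    ∃ p' q' r', HessePoint 56 321 p' q' r' ∧ 3 ∣ r' ∧ ∀ k, 3 ^ k ∣ r' → 3 ^ (k + 1) ∣ r := by
  obtain ⟨b, d, ρ, rfl, hred⟩ := h.exists_reducedHesse
  refine hred.exists_descent_eight fun hb => ?_
  have hρ : ¬ 3 ∣ ρ := fun hρ => Int.prime_three.not_isUnit (hred.coprime.isUnit_of_dvd' hb hρ)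
  have hd : 3 ∣ d := (Int.prime_three.dvd_or_dvd hr).resolve_right hρ
  exact absurd (hred.mul_eq ▸ mul_dvd_mul hb hd) (by norm_num)

theorem three_dvd_mul_six (h : HessePoint 30 109 p q r) : 3 ∣ p * q * r := by
  have heq := h.eq
  omega

theorem three_dvd_mul_eight (h : HessePoint 56 321 p q r) : 3 ∣ p * q * r := by
  have key : ∀ p q r : ZMod 3, p ^ 3 + q ^ 3 + r ^ 3 = 0 → p * q * r ≠ 0 → p = r ∧ q = r := by
    decide
  have hsum : 3 ∣ p ^ 3 + q ^ 3 + r ^ 3 := by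
    have heq := h.eq
    omega
  by_contra hpqr
  rw [← Nat.cast_ofNat, ← ZMod.intCast_zmod_eq_zero_iff_dvd] at hsum hpqr
  push_cast at hsum hpqr
  obtain ⟨hp, hq⟩ := key p q r hsum hpqr
  obtain ⟨i, hi⟩ := (ZMod.intCast_eq_intCast_iff_dvd_sub r p 3).1 hp.symm
  obtain ⟨j, hj⟩ := (ZMod.intCast_eq_intCast_iff_dvd_sub r q 3).1 hq.symm
  obtain rfl : p = r + 3 * i := by linear_combination hi
  obtain rfl : q = r + 3 * j := by linear_combination hj
  have h17 : 17 * r ^ 3 = 3 * (56 * r * (i ^ 2 + j ^ 2) + 56 * (i ^ 3 + j ^ 3) -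
      17 * r ^ 2 * (i + j) - 107 * r * i * j) := by
    linarith [h.eq]
  have hr : 3 ∣ r := Int.prime_three.dvd_of_dvd_pow (n := 3)
    ((Int.prime_three.dvd_or_dvd ⟨_, h17⟩).resolve_left (by norm_num))
  exact hpqr (by rw [(ZMod.intCast_zmod_eq_zero_iff_dvd r 3).2 hr, mul_zero])

theorem exists_three_dvd (h : HessePoint s n p q r) (hs : ¬ 9 ∣ s) (h3 : 3 ∣ p * q * r) :
    ∃ p' q' r', HessePoint s n p' q' r' ∧ 3 ∣ r' := by
  obtain ⟨p', q', r', h', -, hk⟩ := h.exists_three_pow_dvd hs h3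
  exact ⟨p', q', r', h', pow_one (3 : ℤ) ▸ hk 1 (by simpa using h3)⟩

theorem left_ne_middle_six (h : HessePoint 30 109 p q r) : p ≠ q := by
  rintro rfl
  have key : ∀ p r : ZMod 7, 30 * (p ^ 3 + p ^ 3 + r ^ 3) = 109 * (p * p * r) → p = 0 ∧ r = 0 := by
    decide
  obtain ⟨hp, hr⟩ := key p r (by exact_mod_cast congrArg (Int.cast : ℤ → ZMod 7) h.eq)
  rw [ZMod.intCast_zmod_eq_zero_iff_dvd] at hp hr
  exact h.primitive.not_int_dvd (by norm_num) hp hp hr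

/-- The new point is the one in which the tangent at `(p : q : r)` meets the cubic again. -/
theorem exists_tangent (h : HessePoint s n p q r) (hpq : p ≠ q) (hqr : q ≠ r) (hrp : r ≠ p) :
    ∃ d p' q' r', p * (q ^ 3 - r ^ 3) = d * p' ∧ r * (p ^ 3 - q ^ 3) = d * r' ∧
      HessePoint s n p' q' r' := by
  have hcube {x y : ℤ} (hxy : x ≠ y) : x ^ 3 - y ^ 3 ≠ 0 :=
    sub_ne_zero.2 ((Odd.strictMono_pow (by decide : Odd 3)).injective.ne hxy)
  obtain ⟨d, p', q', r', hp, -, hr, h'⟩ := exists_of_eq (s := s) (n := n)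
    (u := p * (q ^ 3 - r ^ 3)) (v := q * (r ^ 3 - p ^ 3)) (w := r * (p ^ 3 - q ^ 3))
    (by linear_combination (p ^ 3 - q ^ 3) * (q ^ 3 - r ^ 3) * (r ^ 3 - p ^ 3) * h.eq)
    (by
      rw [show p * (q ^ 3 - r ^ 3) * (q * (r ^ 3 - p ^ 3)) * (r * (p ^ 3 - q ^ 3)) =
        p * q * r * ((q ^ 3 - r ^ 3) * (r ^ 3 - p ^ 3) * (p ^ 3 - q ^ 3)) by ring]
      exact mul_ne_zero h.ne_zero
        (mul_ne_zero (mul_ne_zero (hcube hqr) (hcube hrp)) (hcube hpq)))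
  exact ⟨d, p', q', r', hp, hr, h'⟩

theorem exists_nine_dvd_six (h : HessePoint 30 109 p q r) :
    ∃ p' q' r', HessePoint 30 109 p' q' r' ∧ 9 ∣ r' := by
  obtain ⟨p, q, r, h, hr⟩ := h.exists_three_dvd (by norm_num) h.three_dvd_mul_six
  by_cases h9 : 9 ∣ r
  · exact ⟨p, q, r, h, h9⟩
  have hp := h.not_three_dvd (by norm_num) hr
  have hq : ¬ 3 ∣ q := fun hq => h.rotate.rotate.not_three_dvd (by norm_num) hq hr
  have hpq : 3 ∣ p - q := by
    have hp3 : p % 3 = 1 ∨ p % 3 = 2 := by omega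
    have hpq : 3 ∣ p + q ∨ 3 ∣ p - q := by omega
    refine hpq.resolve_left fun hsum => h9 ?_
    have hpq3 : 3 ∣ p ^ 3 + q ^ 3 := hsum.trans (Odd.add_dvd_pow_add_pow p q (by decide))
    have hr3 : 3 ∣ r ^ 3 := dvd_pow hr three_ne_zero
    have hpqr : 3 ^ 2 ∣ p * q * r := by
      have heq := h.eq
      omega
    exact ((isCoprime_three_iff.2 hp).mul_right
      (isCoprime_three_iff.2 hq)).pow_left.dvd_of_dvd_mul_left hpqr
  obtain ⟨d, p', q', r', hp', hr', h'⟩ := h.exists_tangent h.left_ne_middle_six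
    (fun hqr => hq (hqr ▸ hr)) (fun hrp => hp (hrp ▸ hr))
  have hd : ¬ 3 ∣ d := fun hd => by
    have h3 : 3 ∣ q ^ 3 - r ^ 3 :=
      (Int.prime_three.dvd_or_dvd (hp' ▸ hd.mul_right p')).resolve_left hp
    exact hq (Int.prime_three.dvd_of_dvd_pow ((dvd_sub_left (dvd_pow hr three_ne_zero)).1 h3))
  have hdr : 3 ^ 2 ∣ d * r' := by
    rw [← hr', pow_two]
    exact mul_dvd_mul hr (hpq.trans (sub_dvd_pow_sub_pow p q 3))
  exact ⟨p', q', r', h', (isCoprime_three_iff.2 hd).pow_left.dvd_of_dvd_mul_left hdr⟩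

end HessePoint

theorem not_hessePoint_six {p q r : ℤ} : ¬ HessePoint 30 109 p q r := fun h => by
  obtain ⟨p, q, r, h, h9⟩ := h.exists_nine_dvd_six
  exact HessePoint.false_of_descent (fun p q r h hr => h.exists_descent_six hr) h h9

theorem not_hessePoint_eight {p q r : ℤ} : ¬ HessePoint 56 321 p q r := fun h => by
  obtain ⟨p, q, r, h, h3⟩ := h.exists_three_dvd (by norm_num) h.three_dvd_mul_eight
  exact HessePoint.false_of_descent (fun p q r h hr => h.exists_descent_eight hr) h h3

theorem mainTheorem5 :
    (∀ a : ℚ, a = 6 ∨ a = 8 → ¬ ∃ c : ℚ × ℚ, c ∈ lynessPeriodic a 9) ∧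
    ((¬ ∃ c : ℚ × ℚ, 0 < c.1 ∧ 0 < c.2 ∧ c ∈ lynessPeriodic 9 9) ∧
      (lynessPeriodic 9 9).Infinite) := by
  refine ⟨?_, ?_, lynessPeriodic_nine_infinite⟩
  · rintro a (rfl | rfl) ⟨c, x, hx, -, -, hp⟩
    · obtain ⟨p, q, r, h0, h⟩ := hx.exists_hesse hp (by norm_num)
      obtain ⟨u, v, w, huvw⟩ := HessePoint.exists_of_rat (s := 30) (n := 109) h0
        (by push_cast; linear_combination h)
      exact not_hessePoint_six huvw
    · obtain ⟨p, q, r, h0, h⟩ := hx.exists_hesse hp (by norm_num)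
      obtain ⟨u, v, w, huvw⟩ := HessePoint.exists_of_rat (s := 56) (n := 321) h0
        (by push_cast; linear_combination h)
      exact not_hessePoint_eight huvw
  · rintro ⟨c, h0, h1, x, hx, hx0, hx1, hp⟩
    have hc := hx.onNineCycleCurve hp
    rw [hx0, hx1] at hc
    exact hc.not_pos h0 h1
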